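/- Let $(M^n,g)$ be a connected, complete, noncompact smooth Riemannian manifold without boundary, $n\ge 3$, let $1\le k\le n$, and let $\sigma_k$ be the $\sigma_k$-curvature of $g$, that is, the $k$-th elementary symmetric function of the eigenvalues of $g^{-1}A_g$, where $A_g=\frac{1}{n-2}\left(\mathrm{Ric}_g-\frac{R_g}{2(n-1)}g\right)$ is the Schouten tensor. Suppose that $(M^n,g,f,\lambda)$ is a quasi $k$-Yamabe gradient soliton: $f:M\to\mathbb{R}$ is smooth, $m\neq 0$ and $\lambda$ are real constants, and $$\nabla^2 f-\frac1m\,df\otimes df=(\sigma_k-\lambda)\,g .$$ Let $d$ be the Riemannian distance, $dv_g$ the Riemannian volume measure and $d\mu=e^{-f/m}\,dv_g$. Suppose that for some point $x_0\in M$ and some $r>0$, with $B(r)$ the open ball of radius $r$ centered at $x_0$, $$\int_{M\setminus B(r)} d(x,x_0)^{-1}\,|\nabla f|\,d\mu<\infty ,$$ and that $f$ is $f$-subharmonic, meaning $\Delta f-\frac1m|\nabla f|^2\ge 0$ on $M$. Then $\sigma_k=\lambda$ at every point of $M$; in particular $(M^n,g)$ has constant $\sigma_k$-curvature. -/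

import Mathlib

open scoped Manifold ContDiff Bundle ENNReal

noncomputable section

namespace QuasiYamabe

open MeasureTheory Bundle

variable {n : ℕ} {M : Type*} [TopologicalSpace M] [ChartedSpace (EuclideanSpace ℝ (Fin n)) M]

/-- The partial derivative `∂ᵢ u` of a function `u` on an open subset of `ℝⁿ`. -/
def partialDeriv (i : Fin n) (u : EuclideanSpace ℝ (Fin n) → ℝ)
    (y : EuclideanSpace ℝ (Fin n)) : ℝ :=
  fderiv ℝ u y (EuclideanSpace.single i 1)

/-- The local representative `f ∘ φ⁻¹` of `f` in the chart `φ` around `c`. -/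
def inChart (c : M) (f : M → ℝ) (y : EuclideanSpace ℝ (Fin n)) : ℝ :=
  f ((extChartAt (𝓡 n) c).symm y)

/-- The coordinate vector field `∂ᵢ` of the chart `φ` around `c`, at the point `φ⁻¹ y`. -/
def coordField (c : M) (y : EuclideanSpace ℝ (Fin n)) (i : Fin n) :
    TangentSpace (𝓡 n) ((extChartAt (𝓡 n) c).symm y) :=
  mfderiv (𝓡 n) (𝓡 n) (extChartAt (𝓡 n) c).symm y
    (EuclideanSpace.single i (1 : ℝ) : EuclideanSpace ℝ (Fin n))

section Chart

variable [RiemannianBundle (fun x : M ↦ TangentSpace (𝓡 n) x)]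

/-- The components `gᵢⱼ = g(∂ᵢ, ∂ⱼ)` of the metric in the chart around `c`. -/
def metricMatrix (c : M) (y : EuclideanSpace ℝ (Fin n)) : Matrix (Fin n) (Fin n) ℝ :=
  Matrix.of fun i j ↦ inner ℝ (coordField c y i) (coordField c y j)

/-- The Christoffel symbols `Γˡᵢⱼ` of the Levi-Civita connection in the chart around `c`. -/
def christoffel (c : M) (l i j : Fin n) (y : EuclideanSpace ℝ (Fin n)) : ℝ :=
  (1 / 2) * ∑ s, (metricMatrix c y)⁻¹ l s *
    (partialDeriv i (fun z ↦ metricMatrix c z j s) y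
      + partialDeriv j (fun z ↦ metricMatrix c z i s) y
      - partialDeriv s (fun z ↦ metricMatrix c z i j) y)

/-- The components of the Ricci tensor in the chart around `c`:
`Ricᵢⱼ = ∂ₗ Γˡᵢⱼ - ∂ⱼ Γˡᵢₗ + Γˡₗₛ Γˢᵢⱼ - Γˡⱼₛ Γˢᵢₗ`. -/
def ricciMatrix (c : M) (y : EuclideanSpace ℝ (Fin n)) : Matrix (Fin n) (Fin n) ℝ :=
  Matrix.of fun i j ↦ ∑ l, (partialDeriv l (christoffel c l i j) y
      - partialDeriv j (christoffel c l i l) y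
      + ∑ s, (christoffel c l l s y * christoffel c s i j y
        - christoffel c l j s y * christoffel c s i l y))

/-- The components of the Hessian `∇²f` in the chart around `c`:
`∇²ᵢⱼ f = ∂ᵢ ∂ⱼ f - Γˡᵢⱼ ∂ₗ f`. -/
def hessianMatrix (f : M → ℝ) (c : M) (y : EuclideanSpace ℝ (Fin n)) :
    Matrix (Fin n) (Fin n) ℝ :=
  Matrix.of fun i j ↦ partialDeriv i (partialDeriv j (inChart c f)) y
    - ∑ l, christoffel c l i j y * partialDeriv l (inChart c f) y

/-- The components of `df ⊗ df` in the chart around `c`. -/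
def dfMatrix (f : M → ℝ) (c : M) (y : EuclideanSpace ℝ (Fin n)) : Matrix (Fin n) (Fin n) ℝ :=
  Matrix.of fun i j ↦ partialDeriv i (inChart c f) y * partialDeriv j (inChart c f) y

end Chart

section Pointwise

/-! Geometric quantities at a point `x`. The components of tensors are taken in the coordinate
basis of the distinguished chart around `x`, at `x`. -/

variable (n)

variable [RiemannianBundle (fun x : M ↦ TangentSpace (𝓡 n) x)]

/-- The metric at `x`. -/
def metricAt (x : M) : Matrix (Fin n) (Fin n) ℝ := metricMatrix x (extChartAt (𝓡 n) x x)

/-- The Ricci tensor at `x`. -/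
def ricciAt (x : M) : Matrix (Fin n) (Fin n) ℝ := ricciMatrix x (extChartAt (𝓡 n) x x)

/-- The Hessian of `f` at `x`. -/
def hessianAt (f : M → ℝ) (x : M) : Matrix (Fin n) (Fin n) ℝ :=
  hessianMatrix f x (extChartAt (𝓡 n) x x)

/-- The tensor `df ⊗ df` at `x`. -/
def dfAt (f : M → ℝ) (x : M) : Matrix (Fin n) (Fin n) ℝ := dfMatrix f x (extChartAt (𝓡 n) x x)

/-- The scalar curvature, `R = gⁱʲ Ricᵢⱼ`. -/
def scalarCurvature (x : M) : ℝ := ((metricAt n x)⁻¹ * ricciAt n x).trace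

/-- The Schouten tensor `A = (n - 2)⁻¹ (Ric - R / (2 (n - 1)) g)` at `x`. -/
def schoutenAt (x : M) : Matrix (Fin n) (Fin n) ℝ :=
  (1 / ((n : ℝ) - 2)) • (ricciAt n x - (scalarCurvature n x / (2 * ((n : ℝ) - 1))) • metricAt n x)

/-- The `σₖ`-curvature: the `k`-th elementary symmetric function of the eigenvalues, counted with
multiplicity, of the (`g`-self-adjoint) endomorphism `g⁻¹ A`. -/
def sigmaCurvature (k : ℕ) (x : M) : ℝ :=
  ((metricAt n x)⁻¹ * schoutenAt n x).charpoly.roots.esymm k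

/-- The Laplace-Beltrami operator `Δf = gⁱʲ ∇²ᵢⱼ f`. -/
def laplacian (f : M → ℝ) (x : M) : ℝ := ((metricAt n x)⁻¹ * hessianAt n f x).trace

/-- The gradient of `f` at `x`: the vector that represents `df` through the inner product `g`. -/
def riemannianGradient (f : M → ℝ) (x : M) : TangentSpace (𝓡 n) x :=
  haveI : FiniteDimensional ℝ (TangentSpace (𝓡 n) x) :=
    inferInstanceAs (FiniteDimensional ℝ (EuclideanSpace ℝ (Fin n)))
  haveI : CompleteSpace (TangentSpace (𝓡 n) x) :=
    FiniteDimensional.complete ℝ (TangentSpace (𝓡 n) x)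
  (InnerProductSpace.toDual ℝ (TangentSpace (𝓡 n) x)).symm (mvfderiv (𝓡 n) f x)

variable (M) in
/-- The Riemannian metric of `M`, together with the function `f` and the constants `m ≠ 0` and
`lam`, is a quasi `k`-Yamabe gradient soliton:
`∇²f - (1/m) df ⊗ df = (σₖ - lam) g`, with `f` smooth. -/
structure IsQuasiYamabeGradientSoliton (k : ℕ) (m lam : ℝ) (f : M → ℝ) : Prop where
  m_ne_zero : m ≠ 0
  smooth : ContMDiff (𝓡 n) 𝓘(ℝ, ℝ) ∞ f
  equation : ∀ x : M,
    hessianAt n f x - (1 / m) • dfAt n f x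
      = (sigmaCurvature n k x - lam) • metricAt n x

end Pointwise

section Volume

variable [RiemannianBundle (fun x : M ↦ TangentSpace (𝓡 n) x)] [MeasurableSpace M]

variable (n) in
/-- The Riemannian volume `√(det g) dy¹ ⋯ dyⁿ` on the domain of the chart around `c`, extended by
zero to `M`. -/
def chartVolume (c : M) : Measure M :=
  Measure.map (extChartAt (𝓡 n) c).symm
    ((volume.restrict (extChartAt (𝓡 n) c).target).withDensity
      fun y : EuclideanSpace ℝ (Fin n) ↦ ENNReal.ofReal √(metricMatrix c y).det)

variable (n M) in
/-- The Riemannian volume measure `dv_g`. By the change of variables formula the measures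
`chartVolume c` agree on the overlaps of the chart domains, so their supremum (the least measure
that dominates them all) is the one measure that restricts to each of them on its domain. -/
def riemannianVolume : Measure M := ⨆ c : M, chartVolume n c

variable (n) in
/-- The weighted measure `dμ = e^{-f/m} dv_g`. -/
def weightedVolume (m : ℝ) (f : M → ℝ) : Measure M :=
  (riemannianVolume n M).withDensity fun x ↦ ENNReal.ofReal (Real.exp (-f x / m))

end Volume

end QuasiYamabe

end

/-! Tracing the soliton equation gives `Δf - (1/m) |∇f|² = n (σₖ - λ)`, so it is enough to show that
the left side, written `weightedLaplacian`, vanishes. It equals `e^{f/m} div(e^{-f/m} ∇f)`, hence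
integrates by parts against `dμ`. Take a cutoff `φ` that is `1` on `B(R)`, `0` off `B(2R)`, and
`1/R`-Lipschitz. Since the weighted Laplacian is nonnegative, its integral over `B(R)` is at most
`-∫ ⟨∇f, ∇φ⟩ dμ`. The gradient of `φ` lives where `R ≤ d ≤ 2R`, and there `1/R ≤ 2/d`, so this is at
most `2 ∫_{M \ B(R)} d⁻¹ |∇f| dμ`, a tail of a convergent integral. Letting `R → ∞`, a continuous
nonnegative function has integral zero over every ball, and so is zero.

Most of the work is to justify the integration by parts, `integral_mul_weightedLaplacian`.
Completeness makes closed balls compact (`properSpace_of_isRiemannianManifold`), so `φ` has compact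
support. As `φ` is only Lipschitz, Rademacher's theorem supplies its derivative almost everywhere,
and a partition of unity reduces to one chart. There the identity says that a compactly supported
Lipschitz vector field has divergence of integral zero, once `sum_partialDeriv_weightedFlux` has
identified the weighted Laplacian as a divergence.

The definitions compute the Laplacian at each point in that point's own chart. Its independence of
the chart (`chartWeightedLaplacian_eq`) is deduced weakly: integrated against a bump function, the
expression in any chart gives `-∫ ⟨∇f, ∇ψ⟩ dμ`, which mentions no chart. -/

noncomputable section

namespace QuasiYamabe

open MeasureTheory Bundle

/-! ### Calculus in `ℝⁿ`: derivatives of determinants and inverses, Lipschitz functions. -/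

section Calculus

variable {n : ℕ} {k : WithTop ℕ∞} {s : Set (EuclideanSpace ℝ (Fin n))}
  {y : EuclideanSpace ℝ (Fin n)}

lemma contDiffOn_det {A : EuclideanSpace ℝ (Fin n) → Matrix (Fin n) (Fin n) ℝ}
    (hA : ∀ i j, ContDiffOn ℝ k (fun z ↦ A z i j) s) :
    ContDiffOn ℝ k (fun z ↦ (A z).det) s := by
  simp only [Matrix.det_apply']
  exact ContDiffOn.sum fun σ _ ↦ contDiffOn_const.mul (contDiffOn_prod fun i _ ↦ hA _ _)

/-- Cramer's rule: each entry of the inverse is a determinant divided by the determinant of the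
matrix. -/
lemma contDiffOn_inv_apply {A : EuclideanSpace ℝ (Fin n) → Matrix (Fin n) (Fin n) ℝ}
    (hA : ∀ i j, ContDiffOn ℝ k (fun z ↦ A z i j) s) (hdet : ∀ z ∈ s, (A z).det ≠ 0)
    (i j : Fin n) : ContDiffOn ℝ k (fun z ↦ (A z)⁻¹ i j) s := by
  simp only [Matrix.inv_def, Matrix.smul_apply, Ring.inverse_eq_inv', smul_eq_mul,
    Matrix.adjugate_apply]
  refine ((contDiffOn_det hA).inv hdet).mul (contDiffOn_det fun a b ↦ ?_)
  by_cases h : a = j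
  · subst h; simpa using contDiffOn_const
  · simpa [Matrix.updateRow_ne h] using hA a b

lemma partialDeriv_mul {u v : EuclideanSpace ℝ (Fin n) → ℝ} (i : Fin n)
    (hu : DifferentiableAt ℝ u y) (hv : DifferentiableAt ℝ v y) :
    partialDeriv i (fun z ↦ u z * v z) y
      = u y * partialDeriv i v y + partialDeriv i u y * v y := by
  simp [partialDeriv, fderiv_fun_mul hu hv, mul_comm]

lemma partialDeriv_sum {ι : Type*} {t : Finset ι} {u : ι → EuclideanSpace ℝ (Fin n) → ℝ}
    (i : Fin n) (hu : ∀ a ∈ t, DifferentiableAt ℝ (u a) y) :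
    partialDeriv i (fun z ↦ ∑ a ∈ t, u a z) y = ∑ a ∈ t, partialDeriv i (u a) y := by
  simp [partialDeriv, fderiv_fun_sum hu]

lemma partialDeriv_congr {u v : EuclideanSpace ℝ (Fin n) → ℝ} (i : Fin n)
    (h : u =ᶠ[nhds y] v) : partialDeriv i u y = partialDeriv i v y := by
  simp [partialDeriv, h.fderiv_eq]

lemma partialDeriv_const (i : Fin n) (a : ℝ) :
    partialDeriv i (fun _ ↦ a) y = 0 := by
  simp [partialDeriv]

lemma partialDeriv_comp {u : EuclideanSpace ℝ (Fin n) → ℝ} {h : ℝ → ℝ} {h' : ℝ} (i : Fin n)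
    (hh : HasDerivAt h h' (u y)) (hu : DifferentiableAt ℝ u y) :
    partialDeriv i (fun z ↦ h (u z)) y = h' * partialDeriv i u y := by
  have := (hh.comp_hasFDerivAt y hu.hasFDerivAt).fderiv
  simp only [partialDeriv, Function.comp_def] at this ⊢
  simp [this]

lemma contDiffOn_partialDeriv {u : EuclideanSpace ℝ (Fin n) → ℝ} (hs : IsOpen s)
    (hu : ContDiffOn ℝ ∞ u s) (i : Fin n) : ContDiffOn ℝ ∞ (partialDeriv i u) s :=
  (hu.fderiv_of_isOpen hs (by simp)).clm_apply contDiffOn_const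

lemma differentiableAt_det {A : EuclideanSpace ℝ (Fin n) → Matrix (Fin n) (Fin n) ℝ}
    (hA : ∀ i j, DifferentiableAt ℝ (fun z ↦ A z i j) y) :
    DifferentiableAt ℝ (fun z ↦ (A z).det) y := by
  simp only [Matrix.det_apply']
  fun_prop

/-- Jacobi's formula for the derivative of a determinant. -/
lemma partialDeriv_det {A : EuclideanSpace ℝ (Fin n) → Matrix (Fin n) (Fin n) ℝ}
    (hA : ∀ i j, DifferentiableAt ℝ (fun z ↦ A z i j) y) (l : Fin n) :
    partialDeriv l (fun z ↦ (A z).det) y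
      = ∑ a, ∑ b, (A y).adjugate a b * partialDeriv l (fun z ↦ A z b a) y := by
  -- The product rule in the Leibniz expansion differentiates one column at a time; Cramer's rule
  -- then turns each such determinant into adjugate entries.
  have key : partialDeriv l (fun z ↦ (A z).det) y
      = ∑ a, ((A y).updateCol a (fun b ↦ partialDeriv l (fun z ↦ A z b a) y)).det := by
    simp only [Matrix.det_apply']
    rw [partialDeriv_sum _ (fun σ _ ↦ by fun_prop), Finset.sum_comm]
    refine Finset.sum_congr rfl fun σ _ ↦ ?_
    rw [partialDeriv_mul _ (by fun_prop) (by fun_prop), partialDeriv_const, zero_mul, add_zero,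
      ← Finset.mul_sum]
    congr 1
    rw [partialDeriv, fderiv_finsetProd (fun i _ ↦ hA _ _)]
    simp only [FunLike.coe_sum, Finset.sum_apply, FunLike.coe_smul,
      Pi.smul_apply, smul_eq_mul]
    refine Finset.sum_congr rfl fun a _ ↦ ?_
    rw [← Finset.mul_prod_erase _ _ (Finset.mem_univ a), mul_comm]
    simp only [Matrix.updateCol_self, partialDeriv]
    congr 1
    exact Finset.prod_congr rfl fun b hb ↦ by
      rw [Matrix.updateCol_ne (Finset.ne_of_mem_erase hb)]
  rw [key]
  refine Finset.sum_congr rfl fun a _ ↦ ?_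
  rw [← Matrix.cramer_apply, Matrix.cramer_eq_adjugate_mulVec]
  rfl

/-- Obtained by differentiating `A A⁻¹ = 1`. -/
lemma partialDeriv_inv_apply {A : EuclideanSpace ℝ (Fin n) → Matrix (Fin n) (Fin n) ℝ}
    (hA : ∀ i j, DifferentiableAt ℝ (fun z ↦ A z i j) y)
    (hB : ∀ i j, DifferentiableAt ℝ (fun z ↦ (A z)⁻¹ i j) y)
    (hdet : ∀ᶠ z in nhds y, (A z).det ≠ 0) (l i j : Fin n) :
    partialDeriv l (fun z ↦ (A z)⁻¹ i j) y
      = -∑ a, ∑ b, (A y)⁻¹ i a * partialDeriv l (fun z ↦ A z a b) y * (A y)⁻¹ b j := by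
  set dA : Matrix (Fin n) (Fin n) ℝ := .of fun a b ↦ partialDeriv l (fun z ↦ A z a b) y with hdA
  set dB : Matrix (Fin n) (Fin n) ℝ := .of fun a b ↦ partialDeriv l (fun z ↦ (A z)⁻¹ a b) y
    with hdB
  have h0 : A y * dB + dA * (A y)⁻¹ = 0 := by
    ext a b
    have h1 : (fun z ↦ ∑ c, A z a c * (A z)⁻¹ c b) =ᶠ[nhds y]
        fun _ ↦ (1 : Matrix (Fin n) (Fin n) ℝ) a b := by
      filter_upwards [hdet] with z hz
      rw [← Matrix.mul_apply, Matrix.mul_nonsing_inv _ (isUnit_iff_ne_zero.2 hz)]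
    have h2 := partialDeriv_congr l h1
    rw [partialDeriv_const, partialDeriv_sum _ (fun c _ ↦ (hA a c).fun_mul (hB c b))] at h2
    rw [Matrix.add_apply, Matrix.mul_apply, Matrix.mul_apply, ← Finset.sum_add_distrib,
      Matrix.zero_apply, ← h2]
    exact Finset.sum_congr rfl fun c _ ↦ (partialDeriv_mul _ (hA a c) (hB c b)).symm
  have h1 : dB = -((A y)⁻¹ * dA * (A y)⁻¹) := by
    have h2 : A y * dB = -(dA * (A y)⁻¹) := eq_neg_of_add_eq_zero_left h0
    have h3 : (A y)⁻¹ * (A y * dB) = dB := by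
      rw [← Matrix.mul_assoc, Matrix.nonsing_inv_mul _ (isUnit_iff_ne_zero.2 hdet.self_of_nhds),
        Matrix.one_mul]
    rw [← h3, h2, Matrix.mul_neg, Matrix.mul_assoc]
  have h2 := congrFun (congrFun h1 i) j
  simp only [hdB, Matrix.of_apply] at h2
  rw [h2, Matrix.neg_apply, Matrix.mul_apply]
  simp only [Matrix.mul_apply, Finset.sum_mul]
  rw [Finset.sum_comm]
  rfl

/-- The index algebra behind `∂ᵢ(√g gⁱʲ) = -√g gᵃᵇ Γʲₐᵦ`, with `B = g⁻¹` and `d i a b = ∂ᵢ gₐᵦ`. On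
the left, the first term comes from `√g` and the second from `g⁻¹`. The two positive terms of the
Christoffel symbol contract to the same sum because `B` is symmetric. -/
lemma sum_contraction_eq {B : Fin n → Fin n → ℝ} {d : Fin n → Fin n → Fin n → ℝ}
    (hB : ∀ i j, B i j = B j i) (hd : ∀ i a b, d i a b = d i b a) (j : Fin n) :
    ∑ i, ((1 / 2) * (∑ a, ∑ b, B a b * d i b a) * B i j - ∑ a, ∑ b, B i a * d i a b * B b j)
      = -∑ a, ∑ b, B a b * ((1 / 2) * ∑ s, B j s * (d a b s + d b a s - d s a b)) := by
  have e1 : ∑ i, (∑ a, ∑ b, B a b * d i b a) * B i j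
      = ∑ a, ∑ b, ∑ s, B a b * (B j s * d s a b) := by
    simp only [Finset.sum_mul]
    rw [Finset.sum_comm]
    refine Finset.sum_congr rfl fun a _ ↦ ?_
    rw [Finset.sum_comm]
    refine Finset.sum_congr rfl fun b _ ↦ Finset.sum_congr rfl fun s _ ↦ ?_
    rw [hd s b a, hB s j]; ring
  have e2 : ∑ i, ∑ a, ∑ b, B i a * d i a b * B b j
      = ∑ a, ∑ b, ∑ s, B a b * (B j s * d a b s) := by
    refine Finset.sum_congr rfl fun a _ ↦ Finset.sum_congr rfl fun b _ ↦
      Finset.sum_congr rfl fun s _ ↦ ?_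
    rw [hB s j]; ring
  have e3 : ∑ a, ∑ b, ∑ s, B a b * (B j s * d a b s)
      = ∑ a, ∑ b, ∑ s, B a b * (B j s * d b a s) := by
    rw [Finset.sum_comm]
    refine Finset.sum_congr rfl fun a _ ↦ Finset.sum_congr rfl fun b _ ↦
      Finset.sum_congr rfl fun s _ ↦ ?_
    rw [hB b a]
  have e4 : ∑ a, ∑ b, B a b * ((1 / 2) * ∑ s, B j s * (d a b s + d b a s - d s a b))
      = (1 / 2) * (∑ a, ∑ b, ∑ s, B a b * (B j s * d a b s)
        + ∑ a, ∑ b, ∑ s, B a b * (B j s * d b a s)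
        - ∑ a, ∑ b, ∑ s, B a b * (B j s * d s a b)) := by
    simp only [← Finset.sum_add_distrib, ← Finset.sum_sub_distrib, Finset.mul_sum]
    refine Finset.sum_congr rfl fun a _ ↦ Finset.sum_congr rfl fun b _ ↦
      Finset.sum_congr rfl fun s _ ↦ ?_
    ring
  rw [e4, Finset.sum_sub_distrib, e2, ← e3, ← e1]
  simp only [mul_assoc, ← Finset.mul_sum]
  ring

/-- The divergence of the columns of `√(det G) G⁻¹`, in terms of the derivatives of `G`. -/
lemma sum_partialDeriv_sqrt_det_mul_inv
    {G : EuclideanSpace ℝ (Fin n) → Matrix (Fin n) (Fin n) ℝ}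
    (hG : ∀ i j, DifferentiableAt ℝ (fun z ↦ G z i j) y)
    (hB : ∀ i j, DifferentiableAt ℝ (fun z ↦ (G z)⁻¹ i j) y)
    (hdet : ∀ᶠ z in nhds y, 0 < (G z).det) (hsymm : ∀ z, (G z).IsSymm) (j : Fin n) :
    ∑ i, partialDeriv i (fun z ↦ √(G z).det * (G z)⁻¹ i j) y
      = -√(G y).det * ∑ a, ∑ b, (G y)⁻¹ a b * ((1 / 2) * ∑ s, (G y)⁻¹ j s *
        (partialDeriv a (fun z ↦ G z b s) y + partialDeriv b (fun z ↦ G z a s) y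
          - partialDeriv s (fun z ↦ G z a b) y)) := by
  have hpos := hdet.self_of_nhds
  have hd := differentiableAt_det hG
  have hs : DifferentiableAt ℝ (fun z ↦ √(G z).det) y := hd.sqrt hpos.ne'
  have hsy : ∀ i a b, partialDeriv i (fun z ↦ G z a b) y = partialDeriv i (fun z ↦ G z b a) y :=
    fun i a b ↦ by congr 1; ext z; exact (hsymm z).apply b a
  have hBs : ∀ a b, (G y)⁻¹ a b = (G y)⁻¹ b a := fun a b ↦ by
    have : ((G y)⁻¹).IsSymm := by
      rw [Matrix.IsSymm, Matrix.transpose_nonsing_inv, hsymm y]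
    exact this.apply b a
  rw [neg_mul, ← mul_neg, ← sum_contraction_eq hBs hsy, Finset.mul_sum]
  refine Finset.sum_congr rfl fun i _ ↦ ?_
  rw [partialDeriv_mul _ hs (hB i j),
    partialDeriv_inv_apply hG hB (hdet.mono fun z hz ↦ hz.ne'),
    partialDeriv_comp i (Real.hasDerivAt_sqrt hpos.ne') hd, partialDeriv_det hG]
  have hadj : ∀ a b, (G y).adjugate a b = (G y).det * (G y)⁻¹ a b := fun a b ↦ by
    rw [Matrix.inv_def, Matrix.smul_apply, Ring.inverse_eq_inv', smul_eq_mul,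
      mul_inv_cancel_left₀ hpos.ne']
  simp only [hadj, mul_assoc, ← Finset.mul_sum]
  have h2 : (1 / (2 * √(G y).det)) * (G y).det = √(G y).det * (1 / 2) := by
    have := Real.mul_self_sqrt hpos.le
    have h3 := (Real.sqrt_pos.2 hpos).ne'
    field_simp
    nlinarith
  rw [← mul_assoc (1 / (2 * √(G y).det)), h2]
  ring

/-- Compactness gives one Lipschitz constant on a ball exceeding the support by radius `1`. A point
of the support and a point off that larger ball are at distance at least `1`, so there the sup bound
`C` serves as a Lipschitz constant. -/
lemma exists_lipschitzWith_of_hasCompactSupport {V : Type*} [NormedAddCommGroup V]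
    [NormedSpace ℝ V] [ProperSpace V] {F : V → ℝ} (hF : LocallyLipschitz F)
    (hc : HasCompactSupport F) : ∃ K, LipschitzWith K F := by
  obtain ⟨R, hR⟩ := (show IsCompact (tsupport F) from hc).isBounded.subset_closedBall 0
  obtain ⟨K, hK⟩ := (hF.locallyLipschitzOn (s := Metric.closedBall 0 (R + 1)))
    |>.exists_lipschitzOnWith_of_compact (isCompact_closedBall _ _)
  obtain ⟨C, hC⟩ := hF.continuous.bounded_above_of_compact_support hc
  have hC0 : 0 ≤ C := (norm_nonneg _).trans (hC 0)
  have key : ∀ x z, x ∈ Metric.closedBall (0 : V) (R + 1) →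
      dist (F x) (F z) ≤ max (K : ℝ) C * dist x z := by
    intro x z hx
    by_cases hz : z ∈ Metric.closedBall (0 : V) (R + 1)
    · exact (hK.dist_le_mul x hx z hz).trans
        (mul_le_mul_of_nonneg_right (le_max_left _ _) dist_nonneg)
    · have hFz : F z = 0 := by
        refine image_eq_zero_of_notMem_tsupport fun h ↦ hz ?_
        exact Metric.closedBall_subset_closedBall (by linarith) (hR h)
      by_cases hx' : x ∈ tsupport F
      · have h1 := hR hx'
        simp only [Metric.mem_closedBall, dist_zero_right, not_le] at h1 hz
        have h2 : 1 ≤ dist x z := by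
          have := norm_sub_norm_le z x
          rw [dist_comm, dist_eq_norm]
          linarith
        rw [hFz, dist_zero_right]
        calc ‖F x‖ ≤ C := hC x
          _ ≤ max (K : ℝ) C * 1 := by rw [mul_one]; exact le_max_right _ _
          _ ≤ _ := by gcongr
      · rw [hFz, image_eq_zero_of_notMem_tsupport hx', dist_self]
        positivity
  refine ⟨⟨max (K : ℝ) C, hC0.trans (le_max_right _ _)⟩, LipschitzWith.of_dist_le_mul fun x z ↦ ?_⟩
  by_cases hx : x ∈ Metric.closedBall (0 : V) (R + 1)
  · exact key x z hx
  by_cases hz : z ∈ Metric.closedBall (0 : V) (R + 1)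
  · rw [dist_comm, dist_comm x]; exact key z x hz
  have h0 : ∀ x ∉ Metric.closedBall (0 : V) (R + 1), F x = 0 := fun x hx ↦
    image_eq_zero_of_notMem_tsupport fun h ↦
      hx (Metric.closedBall_subset_closedBall (by linarith) (hR h))
  rw [h0 x hx, h0 z hz, dist_self]
  exact mul_nonneg (NNReal.coe_nonneg _) dist_nonneg

lemma ae_differentiableAt_of_locallyLipschitz {F : EuclideanSpace ℝ (Fin n) → ℝ}
    (hF : LocallyLipschitz F) (hc : HasCompactSupport F) :
    ∀ᵐ z, DifferentiableAt ℝ F z :=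
  (exists_lipschitzWith_of_hasCompactSupport hF hc).choose_spec.ae_differentiableAt

lemma integrable_partialDeriv_of_locallyLipschitz {F : EuclideanSpace ℝ (Fin n) → ℝ}
    (hF : LocallyLipschitz F) (hc : HasCompactSupport F) (i : Fin n) :
    Integrable (partialDeriv i F) := by
  obtain ⟨K, hK⟩ := exists_lipschitzWith_of_hasCompactSupport hF hc
  have h1 : IntegrableOn (partialDeriv i F) (tsupport F) := by
    refine Measure.integrableOn_of_bounded (M := K * ‖EuclideanSpace.single i (1 : ℝ)‖)
      (show IsCompact (tsupport F) from hc).measure_lt_top.ne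
      (measurable_fderiv_apply_const ℝ F _).aestronglyMeasurable (.of_forall fun z ↦ ?_)
    exact (ContinuousLinearMap.le_opNorm _ _).trans
      (mul_le_mul_of_nonneg_right (norm_fderiv_le_of_lipschitz ℝ hK) (norm_nonneg _))
  refine (integrableOn_iff_integrable_of_support_subset fun z hz ↦ ?_).1 h1
  refine support_fderiv_subset ℝ (f := F) fun h ↦ hz ?_
  simp [partialDeriv, h]

/-- The integral of a partial derivative of a locally Lipschitz, compactly supported function
vanishes. -/
lemma integral_partialDeriv_eq_zero {F : EuclideanSpace ℝ (Fin n) → ℝ}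
    (hF : LocallyLipschitz F) (hc : HasCompactSupport F) (i : Fin n) :
    ∫ z, partialDeriv i F z = 0 := by
  obtain ⟨K, hK⟩ := exists_lipschitzWith_of_hasCompactSupport hF hc
  -- Integration by parts for Lipschitz functions against the constant `1`. That formula negates the
  -- direction on the second factor, so `-eᵢ` is used to get `∂ᵢ F`.
  have h := LipschitzWith.integral_lineDeriv_mul_eq (μ := volume)
    (LipschitzWith.const (α := EuclideanSpace ℝ (Fin n)) (1 : ℝ)) hK hc
    (-EuclideanSpace.single i 1)
  have h0 : ∀ z v : EuclideanSpace ℝ (Fin n),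
      lineDeriv ℝ (fun _ : EuclideanSpace ℝ (Fin n) ↦ (1 : ℝ)) z v = 0 := fun z v ↦ by
    simp [lineDeriv]
  simp only [h0, zero_mul, integral_zero, neg_neg, mul_one] at h
  rw [h]
  refine integral_congr_ae ?_
  filter_upwards [hK.ae_differentiableAt] with z hz
  exact hz.lineDeriv_eq_fderiv.symm

end Calculus

/-! ### Coordinate fields and the gradient. -/

section CoordinateFields

variable {n : ℕ} {M : Type*} [TopologicalSpace M] [ChartedSpace (EuclideanSpace ℝ (Fin n)) M]

lemma mfderiv_chart_symm_eq_sum (c : M) (y v : EuclideanSpace ℝ (Fin n)) :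
    mfderiv (𝓡 n) (𝓡 n) (extChartAt (𝓡 n) c).symm y v = ∑ i, v i • coordField c y i := by
  have : v = ∑ i, v i • (EuclideanSpace.single i (1 : ℝ) : EuclideanSpace ℝ (Fin n)) := by
    ext j; simp [Finset.sum_apply, Pi.single_apply]
  conv_lhs => rw [this]
  erw [map_sum]
  refine Finset.sum_congr rfl fun i _ ↦ ?_
  erw [map_smul]
  rfl

variable [RiemannianBundle (fun x : M ↦ TangentSpace (𝓡 n) x)]

lemma metricMatrix_isSymm (c : M) (y : EuclideanSpace ℝ (Fin n)) :
    (metricMatrix c y).IsSymm := by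
  ext i j
  simp only [metricMatrix, Matrix.transpose_apply, Matrix.of_apply]
  exact real_inner_comm _ _

lemma inner_mfderiv_chart_symm (c : M) (y v w : EuclideanSpace ℝ (Fin n)) :
    inner ℝ (mfderiv (𝓡 n) (𝓡 n) (extChartAt (𝓡 n) c).symm y v)
      (mfderiv (𝓡 n) (𝓡 n) (extChartAt (𝓡 n) c).symm y w)
      = ∑ i, ∑ j, v i * w j * metricMatrix c y i j := by
  rw [mfderiv_chart_symm_eq_sum, mfderiv_chart_symm_eq_sum, sum_inner]
  refine Finset.sum_congr rfl fun i _ ↦ ?_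
  rw [inner_sum]
  refine Finset.sum_congr rfl fun j _ ↦ ?_
  rw [real_inner_smul_left, real_inner_smul_right, metricMatrix, Matrix.of_apply]
  ring

lemma norm_mfderiv_chart_symm_sq (c : M) (y v : EuclideanSpace ℝ (Fin n)) :
    ‖mfderiv (𝓡 n) (𝓡 n) (extChartAt (𝓡 n) c).symm y v‖ ^ 2
      = ∑ i, ∑ j, v i * v j * metricMatrix c y i j := by
  rw [← inner_mfderiv_chart_symm]
  exact (real_inner_self_eq_norm_sq _).symm

lemma inner_riemannianGradient (f : M → ℝ) (x : M) (X : TangentSpace (𝓡 n) x) :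
    inner ℝ (riemannianGradient n f x) X = mvfderiv (𝓡 n) f x X := by
  have : FiniteDimensional ℝ (TangentSpace (𝓡 n) x) :=
    inferInstanceAs (FiniteDimensional ℝ (EuclideanSpace ℝ (Fin n)))
  have : CompleteSpace (TangentSpace (𝓡 n) x) :=
    FiniteDimensional.complete ℝ (TangentSpace (𝓡 n) x)
  exact InnerProductSpace.toDual_symm_apply

variable (n) in
/-- The derivative of `ψ` in the direction of the gradient of `f`. -/
def gradDeriv (f ψ : M → ℝ) (x : M) : ℝ :=
  mvfderiv (𝓡 n) ψ x (riemannianGradient n f x)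

lemma gradDeriv_eq_zero_of_eventuallyEq_const {f ψ : M → ℝ} {x : M} {a : ℝ}
    (h : ψ =ᶠ[nhds x] fun _ ↦ a) : gradDeriv n f ψ x = 0 := by
  rw [gradDeriv, mvfderiv, h.mfderiv_eq, mfderiv_const]
  rfl

lemma norm_riemannianGradient_sq (f : M → ℝ) (x : M) :
    ‖riemannianGradient n f x‖ ^ 2 = gradDeriv n f f x := by
  rw [gradDeriv, ← inner_riemannianGradient, real_inner_self_eq_norm_sq]

end CoordinateFields

/-! ### Smoothness and positivity of the metric in a chart. -/

section ChartGeometry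

variable {n : ℕ} {M : Type*} [TopologicalSpace M] [ChartedSpace (EuclideanSpace ℝ (Fin n)) M]
  [IsManifold (𝓡 n) ∞ M]

lemma isInvertible_mfderiv_chart_symm {c : M} {y : EuclideanSpace ℝ (Fin n)}
    (hy : y ∈ (extChartAt (𝓡 n) c).target) :
    (mfderiv (𝓡 n) (𝓡 n) (extChartAt (𝓡 n) c).symm y).IsInvertible := by
  have : IsManifold (𝓡 n) 1 M := .of_le (n := ∞) (by simp)
  have := isInvertible_mfderivWithin_extChartAt_symm (I := 𝓡 n) hy
  simpa [mfderivWithin_univ] using this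

lemma contMDiffOn_chart_symm (c : M) :
    ContMDiffOn (𝓡 n) (𝓡 n) ∞ (extChartAt (𝓡 n) c).symm (extChartAt (𝓡 n) c).target :=
  contMDiffOn_extChartAt_symm c

lemma mdifferentiableAt_chart_symm {c : M} {y : EuclideanSpace ℝ (Fin n)}
    (hy : y ∈ (extChartAt (𝓡 n) c).target) :
    MDifferentiableAt (𝓡 n) (𝓡 n) (extChartAt (𝓡 n) c).symm y :=
  ((contMDiffOn_chart_symm c).contMDiffAt
    ((isOpen_extChartAt_target c).mem_nhds hy)).mdifferentiableAt (by simp)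

/-- The field is the tangent map of the inverse chart applied to a constant section. -/
lemma contMDiffOn_coordField (c : M) (i : Fin n) :
    ContMDiffOn (𝓡 n) ((𝓡 n).prod 𝓘(ℝ, EuclideanSpace ℝ (Fin n))) ∞
      (fun y ↦ (⟨(extChartAt (𝓡 n) c).symm y, coordField c y i⟩ : TangentBundle (𝓡 n) M))
      (extChartAt (𝓡 n) c).target := by
  have h1 := (contMDiffOn_chart_symm (n := n) c).contMDiffOn_tangentMapWithin (m := ∞) (by simp)
    (isOpen_extChartAt_target c).uniqueMDiffOn
  have h2 : ContMDiffOn (𝓡 n) ((𝓡 n).prod 𝓘(ℝ, EuclideanSpace ℝ (Fin n))) ∞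
      (fun y ↦ (⟨y, (EuclideanSpace.single i (1 : ℝ) : EuclideanSpace ℝ (Fin n))⟩ :
        TangentBundle (𝓡 n) (EuclideanSpace ℝ (Fin n)))) (extChartAt (𝓡 n) c).target :=
    contMDiffOn_vectorSpace_iff_contDiffOn.2 contDiffOn_const
  refine (h1.comp h2 fun y hy ↦ hy).congr fun y hy ↦ ?_
  simp only [Function.comp_def, tangentMapWithin, coordField]
  rw [mfderivWithin_of_mem_nhds ((isOpen_extChartAt_target c).mem_nhds hy)]

variable [RiemannianBundle (fun x : M ↦ TangentSpace (𝓡 n) x)]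

/-- The quadratic form is the squared length of the image of `v` under the differential of the
inverse chart, which is injective. -/
lemma posDef_metricMatrix {c : M} {y : EuclideanSpace ℝ (Fin n)}
    (hy : y ∈ (extChartAt (𝓡 n) c).target) : (metricMatrix c y).PosDef := by
  refine Matrix.PosDef.of_dotProduct_mulVec_pos ?_ fun v hv ↦ ?_
  · rw [Matrix.IsHermitian, Matrix.conjTranspose_eq_transpose_of_trivial]
    exact metricMatrix_isSymm c y
  · have h := inner_mfderiv_chart_symm c y (WithLp.toLp 2 v) (WithLp.toLp 2 v)
    have h1 : star v ⬝ᵥ (metricMatrix c y).mulVec v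
        = ∑ i, ∑ j, v i * v j * metricMatrix c y i j := by
      simp only [dotProduct, Matrix.mulVec, star_trivial, Finset.mul_sum]
      exact Finset.sum_congr rfl fun i _ ↦ Finset.sum_congr rfl fun j _ ↦ by ring
    rw [h1]
    refine lt_of_lt_of_eq (real_inner_self_pos.2 fun h0 ↦ hv ?_) h
    have h2 := (isInvertible_mfderiv_chart_symm hy).injective (h0.trans (map_zero _).symm)
    exact congrArg WithLp.ofLp h2

lemma det_metricMatrix_pos {c : M} {y : EuclideanSpace ℝ (Fin n)}
    (hy : y ∈ (extChartAt (𝓡 n) c).target) : 0 < (metricMatrix c y).det :=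
  (posDef_metricMatrix hy).det_pos

lemma contDiffOn_metricMatrix [IsContMDiffRiemannianBundle (𝓡 n) ∞ (EuclideanSpace ℝ (Fin n))
      (fun x : M ↦ TangentSpace (𝓡 n) x)] (c : M) (i j : Fin n) :
    ContDiffOn ℝ ∞ (fun y ↦ metricMatrix c y i j) (extChartAt (𝓡 n) c).target := by
  rw [← contMDiffOn_iff_contDiffOn]
  exact ContMDiffOn.inner_bundle (F := EuclideanSpace ℝ (Fin n))
    (E := fun x : M ↦ TangentSpace (𝓡 n) x)
    (contMDiffOn_coordField c i) (contMDiffOn_coordField c j)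

end ChartGeometry

/-! ### Differentials and gradients in coordinates. -/

section Gradient

variable {n : ℕ} {M : Type*} [TopologicalSpace M] [ChartedSpace (EuclideanSpace ℝ (Fin n)) M]
  [IsManifold (𝓡 n) ∞ M]

lemma contDiffOn_inChart {f : M → ℝ} (hf : ContMDiff (𝓡 n) 𝓘(ℝ, ℝ) ∞ f) (c : M) :
    ContDiffOn ℝ ∞ (inChart (n := n) c f) (extChartAt (𝓡 n) c).target := by
  rw [← contMDiffOn_iff_contDiffOn]
  exact hf.comp_contMDiffOn (contMDiffOn_chart_symm c)

lemma contDiffOn_weight {f : M → ℝ} (hf : ContMDiff (𝓡 n) 𝓘(ℝ, ℝ) ∞ f) (m : ℝ) (c : M) :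
    ContDiffOn ℝ ∞ (fun y : EuclideanSpace ℝ (Fin n) ↦ Real.exp (-inChart c f y / m))
      (extChartAt (𝓡 n) c).target :=
  ((contDiffOn_inChart hf c).neg.div_const m).exp

lemma mdifferentiableAt_iff_inChart {c : M} {y : EuclideanSpace ℝ (Fin n)}
    (hy : y ∈ (extChartAt (𝓡 n) c).target) (ψ : M → ℝ) :
    MDifferentiableAt (𝓡 n) 𝓘(ℝ, ℝ) ψ ((extChartAt (𝓡 n) c).symm y)
      ↔ DifferentiableAt ℝ (inChart c ψ) y := by
  have : IsManifold (𝓡 n) 1 M := .of_le (n := ∞) (by simp)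
  rw [← mdifferentiableAt_iff_differentiableAt]
  constructor
  · intro h
    exact h.comp y (mdifferentiableAt_chart_symm hy)
  · intro h
    have hx := (extChartAt (𝓡 n) c).map_target hy
    have h1 : MDifferentiableAt (𝓡 n) 𝓘(ℝ, EuclideanSpace ℝ (Fin n)) (extChartAt (𝓡 n) c)
        ((extChartAt (𝓡 n) c).symm y) :=
      mdifferentiableAt_extChartAt (by rwa [extChartAt_source] at hx)
    rw [← (extChartAt (𝓡 n) c).right_inv hy] at h
    refine (h.comp _ h1).congr_of_eventuallyEq ?_
    filter_upwards [(isOpen_extChartAt_source c).mem_nhds hx] with z hz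
    exact congrArg ψ ((extChartAt (𝓡 n) c).left_inv hz).symm

lemma mvfderiv_mfderiv_chart_symm {c : M} {y : EuclideanSpace ℝ (Fin n)}
    (hy : y ∈ (extChartAt (𝓡 n) c).target) (ψ : M → ℝ) (v : EuclideanSpace ℝ (Fin n)) :
    mvfderiv (𝓡 n) ψ ((extChartAt (𝓡 n) c).symm y)
        (mfderiv (𝓡 n) (𝓡 n) (extChartAt (𝓡 n) c).symm y v)
      = fderiv ℝ (inChart c ψ) y v := by
  by_cases h : MDifferentiableAt (𝓡 n) 𝓘(ℝ, ℝ) ψ ((extChartAt (𝓡 n) c).symm y)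
  · have h1 := mfderiv_comp y h (mdifferentiableAt_chart_symm hy)
    have h2 : mfderiv (𝓡 n) 𝓘(ℝ, ℝ) (ψ ∘ (extChartAt (𝓡 n) c).symm) y
        = fderiv ℝ (inChart c ψ) y := mfderiv_eq_fderiv
    rw [h2] at h1
    rw [h1]
    rfl
  -- Where `ψ` is not differentiable both derivatives take the default value `0`, so no regularity
  -- hypothesis is needed.
  · have h' := h
    rw [mdifferentiableAt_iff_inChart hy] at h'
    rw [fderiv_zero_of_not_differentiableAt h', mvfderiv,
      mfderiv_zero_of_not_mdifferentiableAt h]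
    rfl

lemma mvfderiv_coordField {c : M} {y : EuclideanSpace ℝ (Fin n)}
    (hy : y ∈ (extChartAt (𝓡 n) c).target) (ψ : M → ℝ) (i : Fin n) :
    mvfderiv (𝓡 n) ψ ((extChartAt (𝓡 n) c).symm y) (coordField c y i)
      = partialDeriv i (inChart c ψ) y :=
  mvfderiv_mfderiv_chart_symm hy ψ _

lemma exists_eq_sum_coordField {c : M} {y : EuclideanSpace ℝ (Fin n)}
    (hy : y ∈ (extChartAt (𝓡 n) c).target)
    (X : TangentSpace (𝓡 n) ((extChartAt (𝓡 n) c).symm y)) :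
    ∃ v : EuclideanSpace ℝ (Fin n),
      mfderiv (𝓡 n) (𝓡 n) (extChartAt (𝓡 n) c).symm y v = X ∧
      X = ∑ i, v i • coordField c y i := by
  obtain ⟨v, hv⟩ := (isInvertible_mfderiv_chart_symm hy).surjective X
  exact ⟨v, hv, hv.symm.trans (mfderiv_chart_symm_eq_sum c y v)⟩

variable [RiemannianBundle (fun x : M ↦ TangentSpace (𝓡 n) x)]

/-- Pairing the gradient with the coordinate fields shows that its components `v` solve `G v = ∂f`;
invert `G`. -/
lemma gradDeriv_chart {c : M} {y : EuclideanSpace ℝ (Fin n)}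
    (hy : y ∈ (extChartAt (𝓡 n) c).target) (f ψ : M → ℝ) :
    gradDeriv n f ψ ((extChartAt (𝓡 n) c).symm y)
      = ∑ i, ∑ j, (metricMatrix c y)⁻¹ i j * partialDeriv j (inChart c f) y
          * partialDeriv i (inChart c ψ) y := by
  obtain ⟨v, -, hv⟩ := exists_eq_sum_coordField hy
    (riemannianGradient n f ((extChartAt (𝓡 n) c).symm y))
  have h1 : (metricMatrix c y).mulVec v.ofLp = fun j ↦ partialDeriv j (inChart c f) y := by
    ext j
    rw [← mvfderiv_coordField hy, ← inner_riemannianGradient, hv, sum_inner, Matrix.mulVec,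
      dotProduct]
    refine Finset.sum_congr rfl fun i _ ↦ ?_
    rw [real_inner_smul_left, ← (metricMatrix_isSymm c y).apply, metricMatrix, Matrix.of_apply,
      mul_comm]
  have h2 : v.ofLp = (metricMatrix c y)⁻¹.mulVec fun j ↦ partialDeriv j (inChart c f) y := by
    rw [← h1, Matrix.mulVec_mulVec,
      Matrix.nonsing_inv_mul _ (isUnit_iff_ne_zero.2 (det_metricMatrix_pos hy).ne'),
      Matrix.one_mulVec]
  rw [gradDeriv, hv]
  refine (map_sum (mvfderiv (𝓡 n) ψ ((extChartAt (𝓡 n) c).symm y)) _ _).trans ?_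
  refine Finset.sum_congr rfl fun i _ ↦ ?_
  rw [map_smul, mvfderiv_coordField hy, congrFun h2 i, smul_eq_mul]
  simp only [Matrix.mulVec, dotProduct, Finset.sum_mul]

end Gradient

/-! ### The weighted Laplacian as a divergence. -/

section WeightedLaplacian

variable {n : ℕ} {M : Type*} [TopologicalSpace M] [ChartedSpace (EuclideanSpace ℝ (Fin n)) M]
  [RiemannianBundle (fun x : M ↦ TangentSpace (𝓡 n) x)]

/-- The operator `Δf - (1/m) |∇f|²`, computed in the chart around `c`. -/
def chartWeightedLaplacian (m : ℝ) (f : M → ℝ) (c : M) (y : EuclideanSpace ℝ (Fin n)) : ℝ :=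
  ((metricMatrix c y)⁻¹ * hessianMatrix f c y).trace
    - (1 / m) * ∑ i, ∑ j, (metricMatrix c y)⁻¹ i j * partialDeriv j (inChart c f) y
          * partialDeriv i (inChart c f) y

variable (n) in
/-- The operator `Δf - (1/m) |∇f|²`. -/
def weightedLaplacian (m : ℝ) (f : M → ℝ) (x : M) : ℝ :=
  laplacian n f x - (1 / m) * ‖riemannianGradient n f x‖ ^ 2

/-- The components of the vector density `√(det g) e^{-f/m} ∇f` in the chart around `c`. -/
def weightedFlux (m : ℝ) (f : M → ℝ) (c : M) (i : Fin n) (y : EuclideanSpace ℝ (Fin n)) : ℝ :=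
  ∑ j, (√(metricMatrix c y).det * (metricMatrix c y)⁻¹ i j)
    * (Real.exp (-inChart c f y / m) * partialDeriv j (inChart c f) y)

variable [IsManifold (𝓡 n) ∞ M]

lemma weightedLaplacian_eq_chart (m : ℝ) (f : M → ℝ) (x : M) :
    weightedLaplacian n m f x = chartWeightedLaplacian m f x (extChartAt (𝓡 n) x x) := by
  have h := gradDeriv_chart (mem_extChartAt_target (I := 𝓡 n) x) f f
  rw [extChartAt_to_inv] at h
  rw [weightedLaplacian, norm_riemannianGradient_sq, h]
  rfl

variable [IsContMDiffRiemannianBundle (𝓡 n) ∞ (EuclideanSpace ℝ (Fin n))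
      (fun x : M ↦ TangentSpace (𝓡 n) x)]

lemma contDiffOn_metricMatrix_inv (c : M) (i j : Fin n) :
    ContDiffOn ℝ ∞ (fun y ↦ (metricMatrix c y)⁻¹ i j) (extChartAt (𝓡 n) c).target :=
  contDiffOn_inv_apply (contDiffOn_metricMatrix c) (fun _ hz ↦ (det_metricMatrix_pos hz).ne') i j

lemma contDiffOn_sqrt_det_metricMatrix (c : M) :
    ContDiffOn ℝ ∞ (fun y : EuclideanSpace ℝ (Fin n) ↦ √(metricMatrix c y).det)
      (extChartAt (𝓡 n) c).target :=
  (contDiffOn_det (contDiffOn_metricMatrix c)).sqrt fun _ hz ↦ (det_metricMatrix_pos hz).ne'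

lemma contDiffOn_christoffel (c : M) (l i j : Fin n) :
    ContDiffOn ℝ ∞ (christoffel c l i j) (extChartAt (𝓡 n) c).target := by
  have hd : ∀ a b e : Fin n, ContDiffOn ℝ ∞ (partialDeriv a fun z ↦ metricMatrix c z b e)
      (extChartAt (𝓡 n) c).target := fun a b e ↦
    contDiffOn_partialDeriv (isOpen_extChartAt_target c) (contDiffOn_metricMatrix c b e) a
  exact contDiffOn_const.mul (ContDiffOn.sum fun s _ ↦
    (contDiffOn_metricMatrix_inv c l s).mul (((hd i j s).add (hd j i s)).sub (hd s i j)))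

lemma contDiffOn_weightedFlux {f : M → ℝ} (hf : ContMDiff (𝓡 n) 𝓘(ℝ, ℝ) ∞ f)
    (m : ℝ) (c : M) (i : Fin n) :
    ContDiffOn ℝ ∞ (weightedFlux (n := n) m f c i) (extChartAt (𝓡 n) c).target :=
  ContDiffOn.sum fun j _ ↦ ((contDiffOn_sqrt_det_metricMatrix c).mul
    (contDiffOn_metricMatrix_inv c i j)).mul ((contDiffOn_weight hf m c).mul
      (contDiffOn_partialDeriv (isOpen_extChartAt_target c) (contDiffOn_inChart hf c) j))

lemma continuousOn_chartWeightedLaplacian {f : M → ℝ} (hf : ContMDiff (𝓡 n) 𝓘(ℝ, ℝ) ∞ f)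
    (m : ℝ) (c : M) :
    ContinuousOn (chartWeightedLaplacian (n := n) m f c) (extChartAt (𝓡 n) c).target := by
  have hd : ∀ i : Fin n, ContDiffOn ℝ ∞ (partialDeriv i (inChart c f))
      (extChartAt (𝓡 n) c).target := fun i ↦
    contDiffOn_partialDeriv (isOpen_extChartAt_target c) (contDiffOn_inChart hf c) i
  have hdd : ∀ i j : Fin n, ContDiffOn ℝ ∞ (partialDeriv i (partialDeriv j (inChart c f)))
      (extChartAt (𝓡 n) c).target := fun i j ↦
    contDiffOn_partialDeriv (isOpen_extChartAt_target c) (hd j) i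
  refine ContDiffOn.continuousOn (𝕜 := ℝ) (n := ∞) (ContDiffOn.sub ?_ ?_)
  · simp only [Matrix.trace, Matrix.diag, Matrix.mul_apply, hessianMatrix, Matrix.of_apply]
    exact ContDiffOn.sum fun i _ ↦ ContDiffOn.sum fun j _ ↦
      (contDiffOn_metricMatrix_inv c i j).mul ((hdd j i).sub
        (ContDiffOn.sum fun l _ ↦ (contDiffOn_christoffel c l j i).mul (hd l)))
  · exact contDiffOn_const.mul (ContDiffOn.sum fun i _ ↦ ContDiffOn.sum fun j _ ↦
      ((contDiffOn_metricMatrix_inv c i j).mul (hd j)).mul (hd i))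

/-- The weighted Laplacian is the weighted divergence of the gradient. -/
lemma sum_partialDeriv_weightedFlux {f : M → ℝ} (hf : ContMDiff (𝓡 n) 𝓘(ℝ, ℝ) ∞ f)
    (m : ℝ) {c : M} {y : EuclideanSpace ℝ (Fin n)}
    (hy : y ∈ (extChartAt (𝓡 n) c).target) :
    ∑ i, partialDeriv i (weightedFlux m f c i) y
      = √(metricMatrix c y).det * Real.exp (-inChart c f y / m)
          * chartWeightedLaplacian m f c y := by
  have hU := (isOpen_extChartAt_target (I := 𝓡 n) c).mem_nhds hy
  have diff : ∀ {u : EuclideanSpace ℝ (Fin n) → ℝ},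
      ContDiffOn ℝ ∞ u (extChartAt (𝓡 n) c).target → DifferentiableAt ℝ u y :=
    fun hu ↦ (hu.contDiffAt hU).differentiableAt (by simp)
  have hG := fun i j ↦ diff (contDiffOn_metricMatrix c i j)
  have hB := fun i j ↦ diff (contDiffOn_metricMatrix_inv c i j)
  have hs := diff (contDiffOn_sqrt_det_metricMatrix c)
  have hu := diff (contDiffOn_inChart hf c)
  have hw := diff (contDiffOn_weight hf m c)
  have hd : ∀ j, DifferentiableAt ℝ (partialDeriv j (inChart c f)) y := fun j ↦
    diff (contDiffOn_partialDeriv (isOpen_extChartAt_target c) (contDiffOn_inChart hf c) j)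
  have hdet : ∀ᶠ z in nhds y, 0 < (metricMatrix c z).det := by
    filter_upwards [hU] with z hz using det_metricMatrix_pos hz
  -- Differentiating the weight produces the `-(1/m) |∇f|²` term.
  have hdw : ∀ i, partialDeriv i (fun z ↦ Real.exp (-inChart c f z / m)) y
      = -(1 / m) * Real.exp (-inChart c f y / m) * partialDeriv i (inChart c f) y := by
    intro i
    have : HasDerivAt (fun t : ℝ ↦ Real.exp (-t / m))
        (Real.exp (-inChart c f y / m) * (-1 / m)) (inChart c f y) :=
      ((hasDerivAt_id _).neg.div_const m).exp
    rw [partialDeriv_comp i this hu]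
    ring
  have h1 : ∀ i, partialDeriv i (weightedFlux m f c i) y
      = ∑ j, (√(metricMatrix c y).det * (metricMatrix c y)⁻¹ i j
          * (Real.exp (-inChart c f y / m) * partialDeriv i (partialDeriv j (inChart c f)) y
            + -(1 / m) * Real.exp (-inChart c f y / m) * partialDeriv i (inChart c f) y
              * partialDeriv j (inChart c f) y)
        + partialDeriv i (fun z ↦ √(metricMatrix c z).det * (metricMatrix c z)⁻¹ i j) y
          * (Real.exp (-inChart c f y / m) * partialDeriv j (inChart c f) y)) := by
    intro i
    have := partialDeriv_sum (t := Finset.univ) (y := y) (u := fun j z ↦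
      (√(metricMatrix c z).det * (metricMatrix c z)⁻¹ i j)
        * (Real.exp (-inChart c f z / m) * partialDeriv j (inChart c f) z)) i
      (fun j _ ↦ (hs.fun_mul (hB i j)).fun_mul (hw.fun_mul (hd j)))
    refine this.trans (Finset.sum_congr rfl fun j _ ↦ ?_)
    rw [partialDeriv_mul i (hs.fun_mul (hB i j)) (hw.fun_mul (hd j)),
      partialDeriv_mul i hw (hd j), hdw]
  -- Differentiating the density `√g gⁱʲ` produces the Christoffel term of the Hessian.
  have h2 : ∑ i, ∑ j,
      partialDeriv i (fun z ↦ √(metricMatrix c z).det * (metricMatrix c z)⁻¹ i j) y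
          * (Real.exp (-inChart c f y / m) * partialDeriv j (inChart c f) y)
      = -√(metricMatrix c y).det * Real.exp (-inChart c f y / m) * ∑ a, ∑ b,
        (metricMatrix c y)⁻¹ a b * ∑ l, christoffel c l a b y * partialDeriv l (inChart c f) y := by
    rw [Finset.sum_comm]
    simp only [← Finset.sum_mul]
    simp only [sum_partialDeriv_sqrt_det_mul_inv hG hB hdet (metricMatrix_isSymm c)]
    change ∑ j, -√(metricMatrix c y).det * (∑ a, ∑ b, (metricMatrix c y)⁻¹ a b *
      christoffel c j a b y) * _ = _
    simp only [Finset.mul_sum, Finset.sum_mul]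
    rw [Finset.sum_comm]
    refine Finset.sum_congr rfl fun a _ ↦ ?_
    rw [Finset.sum_comm]
    refine Finset.sum_congr rfl fun b _ ↦ Finset.sum_congr rfl fun l _ ↦ ?_
    ring
  simp only [h1, Finset.sum_add_distrib, h2]
  have hBs : ∀ a b, (metricMatrix c y)⁻¹ a b = (metricMatrix c y)⁻¹ b a := fun a b ↦ by
    have : ((metricMatrix c y)⁻¹).IsSymm := by
      rw [Matrix.IsSymm, Matrix.transpose_nonsing_inv, metricMatrix_isSymm c y]
    exact this.apply b a
  simp only [chartWeightedLaplacian, Matrix.trace, Matrix.diag, Matrix.mul_apply, hessianMatrix,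
    Matrix.of_apply]
  have h3 : ∑ i, ∑ j, (metricMatrix c y)⁻¹ i j *
      (partialDeriv j (partialDeriv i (inChart c f)) y
        - ∑ l, christoffel c l j i y * partialDeriv l (inChart c f) y)
      = ∑ i, ∑ j, (metricMatrix c y)⁻¹ i j * partialDeriv i (partialDeriv j (inChart c f)) y
        - ∑ a, ∑ b, (metricMatrix c y)⁻¹ a b
          * ∑ l, christoffel c l a b y * partialDeriv l (inChart c f) y := by
    rw [Finset.sum_comm]
    simp only [← Finset.sum_sub_distrib]
    refine Finset.sum_congr rfl fun i _ ↦ Finset.sum_congr rfl fun j _ ↦ ?_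
    rw [hBs j i]
    ring
  rw [h3]
  have h4 : ∑ i, ∑ j, √(metricMatrix c y).det * (metricMatrix c y)⁻¹ i j
          * (Real.exp (-inChart c f y / m) * partialDeriv i (partialDeriv j (inChart c f)) y
            + -(1 / m) * Real.exp (-inChart c f y / m) * partialDeriv i (inChart c f) y
              * partialDeriv j (inChart c f) y)
      = √(metricMatrix c y).det * Real.exp (-inChart c f y / m) *
        (∑ i, ∑ j, (metricMatrix c y)⁻¹ i j * partialDeriv i (partialDeriv j (inChart c f)) y
          - (1 / m) * ∑ i, ∑ j, (metricMatrix c y)⁻¹ i j * partialDeriv j (inChart c f) y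
          * partialDeriv i (inChart c f) y) := by
    simp only [Finset.mul_sum, ← Finset.sum_sub_distrib]
    refine Finset.sum_congr rfl fun i _ ↦ Finset.sum_congr rfl fun j _ ↦ ?_
    ring
  rw [h4]
  ring

end WeightedLaplacian

/-! ### Hopf–Rinow: completeness implies properness. -/

section LengthSpace

/-- The Hopf–Rinow theorem for length spaces: in a complete, locally compact metric space in which
distances can be split approximately, closed balls are compact. -/
theorem properSpace_of_exists_dist_lt {M : Type*} [MetricSpace M] [CompleteSpace M]
    [LocallyCompactSpace M]
    (hlen : ∀ (x y : M) (a b : ℝ), 0 ≤ a → 0 < b → dist x y < a + b →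
      ∃ z, dist x z ≤ a ∧ dist z y < b) :
    ProperSpace M := by
  refine ⟨fun x R ↦ ?_⟩
  by_cases hR : R < 0
  · simp [Metric.closedBall_eq_empty.2 hR]
  push Not at hR
  set S : Set ℝ := {r | IsCompact (Metric.closedBall x r)} with hS
  have mono : ∀ {r r'}, r' ∈ S → r ≤ r' → r ∈ S := fun h h' ↦
    h.of_isClosed_subset Metric.isClosed_closedBall (Metric.closedBall_subset_closedBall h')
  suffices h : Set.Icc 0 R ⊆ S from h ⟨hR, le_rfl⟩
  have h0 : (0 : ℝ) ∈ S := by simp [hS]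
  -- Continuous induction on the radius: the set of radii with compact ball contains `0`, is closed
  -- in `[0, R]`, and extends to the right of each of its points.
  refine IsClosed.Icc_subset_of_forall_exists_gt ?_ h0 ?_
  · refine isClosed_of_closure_subset fun r hr ↦ ?_
    have hr' : r ∈ Set.Icc 0 R :=
      isClosed_Icc.closure_subset_iff.2 Set.inter_subset_right hr
    refine ⟨?_, hr'⟩
    rcases hr'.1.eq_or_lt with rfl | hpos
    · exact h0
    have hlt : ∀ r' < r, r' ∈ S := fun r' h' ↦ by
      obtain ⟨s, hs, hs'⟩ := mem_closure_iff_nhds.1 hr _ (Ioi_mem_nhds h')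
      exact mono hs'.1 (le_of_lt hs)
    refine isCompact_iff_totallyBounded_isComplete.2
      ⟨Metric.totallyBounded_iff.2 fun ε hε ↦ ?_, Metric.isClosed_closedBall.isComplete⟩
    -- Every point of the `r`-ball is within `2 δ ≤ ε / 2` of the compact `(r - δ)`-ball, so an `ε /
    -- 2`-net of the latter is an `ε`-net of the former. The bound `δ ≤ r` keeps the smaller radius
    -- nonnegative.
    set δ := min (ε / 4) r with hδ
    have hδ0 : 0 < δ := lt_min (by linarith) hpos
    obtain ⟨t, ht, hcov⟩ := Metric.totallyBounded_iff.1
      (hlt (r - δ) (by linarith)).totallyBounded (ε / 2) (by linarith)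
    refine ⟨t, ht, fun y hy ↦ ?_⟩
    obtain ⟨z, hz1, hz2⟩ := hlen x y (r - δ) (2 * δ) (by linarith [min_le_right (ε / 4) r])
      (by linarith)
      (by rw [dist_comm]; linarith [Metric.mem_closedBall.1 hy])
    obtain ⟨p, hp, hzp⟩ := Set.mem_iUnion₂.1 (hcov (Metric.mem_closedBall'.2 hz1))
    refine Set.mem_iUnion₂.2 ⟨p, hp, Metric.mem_ball.2 ?_⟩
    have := dist_triangle y z p
    rw [dist_comm y z] at this
    linarith [Metric.mem_ball.1 hzp, min_le_left (ε / 4) r]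
  · rintro r ⟨hr, hr0, -⟩ s hs
    -- By local compactness some `δ`-thickening of the compact ball lies in a compact set, and
    -- splitting distances puts the ball of radius `r + δ / 2` inside this thickening.
    obtain ⟨K, hK, hKr⟩ := exists_compact_superset (show IsCompact (Metric.closedBall x r) from hr)
    obtain ⟨δ, hδ, hδK⟩ := (show IsCompact (Metric.closedBall x r) from hr)
      |>.exists_thickening_subset_open isOpen_interior hKr
    have hmem : r + δ / 2 ∈ S := by
      refine hK.of_isClosed_subset Metric.isClosed_closedBall fun y hy ↦
        interior_subset (hδK ?_)
      obtain ⟨z, hz1, hz2⟩ := hlen x y r δ hr0 hδ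
        (by rw [dist_comm]; linarith [Metric.mem_closedBall.1 hy])
      exact Metric.mem_thickening_iff.2 ⟨z, Metric.mem_closedBall'.2 hz1, by rwa [dist_comm]⟩
    refine ⟨min (r + δ / 2) s, mono hmem (min_le_left _ _), lt_min (by linarith) hs,
      min_le_right _ _⟩

end LengthSpace

/-! ### The Riemannian distance in charts, and Lipschitz functions. -/

section RiemannianDistance

variable {n : ℕ} {M : Type*} [MetricSpace M] [ChartedSpace (EuclideanSpace ℝ (Fin n)) M]
  [RiemannianBundle (fun x : M ↦ TangentSpace (𝓡 n) x)] [IsRiemannianManifold (𝓡 n) M]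

variable (n) in
-- Join the points by a curve of length less than `a + b` and cut it where the distance from `x`
-- equals `a`; the first piece has length at least `a`, so the second is shorter than `b`.
lemma exists_dist_le_dist_lt [IsManifold (𝓡 n) ∞ M] (x y : M) (a b : ℝ) (ha : 0 ≤ a)
    (hb : 0 < b) (h : dist x y < a + b) :
    ∃ z, dist x z ≤ a ∧ dist z y < b := by
  rcases le_or_gt (dist x y) a with hxy | hxy
  · exact ⟨y, hxy, by simpa using hb⟩
  have h1 : Manifold.riemannianEDist (𝓡 n) x y < ENNReal.ofReal (a + b) := by
    rw [← IsRiemannianManifold.out (I := 𝓡 n) x y, edist_dist]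
    exact (ENNReal.ofReal_lt_ofReal_iff (dist_nonneg.trans_lt h)).2 h
  obtain ⟨γ, γ0, γ1, hγ, hlen⟩ := Manifold.exists_lt_of_riemannianEDist_lt h1
  have hcont : ContinuousOn (fun t ↦ dist x (γ t)) (Set.Icc 0 1) :=
    (continuous_const.dist continuous_id).comp_continuousOn hγ.continuousOn
  obtain ⟨t, ht, hta⟩ := intermediate_value_Icc zero_le_one hcont
    (show a ∈ Set.Icc (dist x (γ 0)) (dist x (γ 1)) from ⟨by simpa [γ0] using ha, by
      simpa [γ1] using hxy.le⟩)
  have e1 : edist x (γ t) ≤ Manifold.pathELength (𝓡 n) γ 0 t := by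
    rw [IsRiemannianManifold.out (I := 𝓡 n)]
    exact Manifold.riemannianEDist_le_pathELength (hγ.mono (Set.Icc_subset_Icc le_rfl ht.2)) γ0 rfl
      ht.1
  have e2 : edist (γ t) y ≤ Manifold.pathELength (𝓡 n) γ t 1 := by
    rw [IsRiemannianManifold.out (I := 𝓡 n)]
    exact Manifold.riemannianEDist_le_pathELength (hγ.mono (Set.Icc_subset_Icc ht.1 le_rfl)) rfl γ1
      ht.2
  have e3 : edist x (γ t) + edist (γ t) y < ENNReal.ofReal (a + b) :=
    (add_le_add e1 e2).trans_lt (by rwa [Manifold.pathELength_add ht.1 ht.2])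
  have hta' : dist x (γ t) = a := hta
  rw [edist_dist, edist_dist, ← ENNReal.ofReal_add dist_nonneg dist_nonneg,
    ENNReal.ofReal_lt_ofReal_iff (dist_nonneg.trans_lt h), hta'] at e3
  exact ⟨γ t, hta'.le, by linarith⟩

variable [IsManifold (𝓡 n) ∞ M]

/-- The distance is at most the length of the image of the straight coordinate segment, whose speed
is bounded by `C`. -/
lemma dist_chart_symm_le {c : M} {y y' : EuclideanSpace ℝ (Fin n)} {C : ℝ}
    (hseg : segment ℝ y y' ⊆ (extChartAt (𝓡 n) c).target)
    (hC : ∀ z ∈ segment ℝ y y',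
      ‖mfderiv (𝓡 n) (𝓡 n) (extChartAt (𝓡 n) c).symm z (y' - y)‖ ≤ C) :
    dist ((extChartAt (𝓡 n) c).symm y) ((extChartAt (𝓡 n) c).symm y') ≤ C := by
  have hC0 : 0 ≤ C := (norm_nonneg _).trans (hC y (left_mem_segment ℝ y y'))
  let η : ℝ →ᴬ[ℝ] EuclideanSpace ℝ (Fin n) := ContinuousAffineMap.lineMap y y'
  have hη : ∀ t ∈ Set.Icc (0 : ℝ) 1, η t ∈ segment ℝ y y' := fun t ht ↦ by
    rw [segment_eq_image_lineMap]
    exact ⟨t, ht, rfl⟩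
  have η_smooth : ContMDiffOn 𝓘(ℝ, ℝ) (𝓡 n) 1 η (Set.Icc 0 1) := by
    apply ContMDiff.contMDiffOn
    rw [contMDiff_iff_contDiff]
    exact ContinuousAffineMap.contDiff _
  have hsmooth : ContMDiffOn 𝓘(ℝ, ℝ) (𝓡 n) 1 ((extChartAt (𝓡 n) c).symm ∘ η) (Set.Icc 0 1) :=
    ((contMDiffOn_chart_symm c).of_le (by simp)).comp η_smooth fun t ht ↦ hseg (hη t ht)
  have h1 : edist ((extChartAt (𝓡 n) c).symm y) ((extChartAt (𝓡 n) c).symm y')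
      ≤ Manifold.pathELength (𝓡 n) ((extChartAt (𝓡 n) c).symm ∘ η) 0 1 := by
    rw [IsRiemannianManifold.out (I := 𝓡 n)]
    refine Manifold.riemannianEDist_le_pathELength hsmooth ?_ ?_ zero_le_one
    · simp [η, ContinuousAffineMap.coe_lineMap_eq]
    · simp [η, ContinuousAffineMap.coe_lineMap_eq]
  have h2 : Manifold.pathELength (𝓡 n) ((extChartAt (𝓡 n) c).symm ∘ η) 0 1
      ≤ ENNReal.ofReal C := by
    rw [Manifold.pathELength_eq_lintegral_mfderivWithin_Icc]
    calc _ ≤ ∫⁻ _ in Set.Icc (0 : ℝ) 1, ENNReal.ofReal C := by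
          refine setLIntegral_mono' measurableSet_Icc fun t ht ↦ ?_
          have hd : HasFDerivWithinAt η (ContinuousLinearMap.smulRight (1 : ℝ →L[ℝ] ℝ) (y' - y))
              (Set.Icc 0 1) t := by
            have : HasDerivAt η (y' - y) t := AffineMap.hasDerivAt_lineMap
            exact this.hasFDerivAt.hasFDerivWithinAt
          have hu : UniqueMDiffWithinAt 𝓘(ℝ, ℝ) (Set.Icc (0 : ℝ) 1) t :=
            (uniqueMDiffWithinAt_iff_uniqueDiffWithinAt).2 (uniqueDiffOn_Icc zero_lt_one t ht)
          have h3 := mfderiv_comp_mfderivWithin t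
            (mdifferentiableAt_chart_symm (hseg (hη t ht)))
            (η_smooth.mdifferentiableOn one_ne_zero t ht) hu
          have h4 : mfderivWithin 𝓘(ℝ, ℝ) (𝓡 n) η (Set.Icc 0 1) t = _ :=
            mfderivWithin_eq_fderivWithin.trans
              (hd.fderivWithin (uniqueDiffOn_Icc zero_lt_one t ht))
          have h5 : mfderivWithin 𝓘(ℝ, ℝ) (𝓡 n) ((extChartAt (𝓡 n) c).symm ∘ η) (Set.Icc 0 1) t
              (1 : ℝ) = mfderiv (𝓡 n) (𝓡 n) (extChartAt (𝓡 n) c).symm (η t) (y' - y) := by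
            rw [h3, h4]
            exact congrArg (mfderiv (𝓡 n) (𝓡 n) (extChartAt (𝓡 n) c).symm (η t))
              (one_smul ℝ (y' - y))
          rw [← ofReal_norm]
          refine ENNReal.ofReal_le_ofReal ?_
          refine le_of_eq_of_le ?_ (hC _ (hη t ht))
          exact congrArg norm h5
      _ = ENNReal.ofReal C := by simp
  have h3 := h1.trans h2
  rwa [edist_dist, ENNReal.ofReal_le_ofReal_iff hC0] at h3

variable [IsContMDiffRiemannianBundle (𝓡 n) ∞ (EuclideanSpace ℝ (Fin n))
      (fun x : M ↦ TangentSpace (𝓡 n) x)]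

/-- The inverse of a chart is locally Lipschitz for the Riemannian distance. -/
lemma locallyLipschitzOn_chart_symm (c : M) :
    LocallyLipschitzOn (extChartAt (𝓡 n) c).target (extChartAt (𝓡 n) c).symm := by
  intro y hy
  have hU := (isOpen_extChartAt_target (I := 𝓡 n) c).mem_nhds hy
  -- Near `y` each metric entry is below its value at `y` plus `1` in modulus, so the squared length
  -- of a coordinate vector `v` is at most `A |v|²`.
  set A : ℝ := ∑ i : Fin n, ∑ j : Fin n, (|metricMatrix c y i j| + 1) with hA
  have hA0 : 0 ≤ A := by positivity
  have hG : ∀ᶠ z in nhds y, ∀ i j, |metricMatrix c z i j| < |metricMatrix c y i j| + 1 := by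
    refine Filter.eventually_all.2 fun i ↦ Filter.eventually_all.2 fun j ↦ ?_
    have := ((contDiffOn_metricMatrix c i j).continuousOn.continuousAt hU).abs
    exact this.eventually (gt_mem_nhds (lt_add_one _))
  obtain ⟨ε, hε, hball⟩ := Metric.mem_nhds_iff.1 (Filter.inter_mem hU hG)
  refine ⟨(√A).toNNReal, Metric.ball y ε,
    mem_nhdsWithin_of_mem_nhds (Metric.ball_mem_nhds y hε), ?_⟩
  refine LipschitzOnWith.of_dist_le_mul fun z hz w hw ↦ ?_
  have hseg : segment ℝ z w ⊆ Metric.ball y ε := (convex_ball y ε).segment_subset hz hw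
  refine dist_chart_symm_le (hseg.trans fun p hp ↦ (hball hp).1) fun p hp ↦ ?_
  refine abs_le_of_sq_le_sq' ?_ (by positivity) |>.2
  rw [norm_mfderiv_chart_symm_sq, mul_pow, Real.coe_toNNReal _ (Real.sqrt_nonneg A),
    Real.sq_sqrt hA0, hA, Finset.sum_mul]
  refine Finset.sum_le_sum fun i _ ↦ ?_
  rw [Finset.sum_mul]
  refine Finset.sum_le_sum fun j _ ↦ ?_
  have hc : ∀ i, |(w - z) i| ≤ dist z w := fun i ↦ by
    rw [dist_comm, dist_eq_norm]; exact PiLp.norm_apply_le (w - z) i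
  calc (w - z) i * (w - z) j * metricMatrix c p i j
      ≤ |(w - z) i * (w - z) j * metricMatrix c p i j| := le_abs_self _
    _ = |(w - z) i| * |(w - z) j| * |metricMatrix c p i j| := by rw [abs_mul, abs_mul]
    _ ≤ dist z w * dist z w * (|metricMatrix c y i j| + 1) := by
      gcongr
      · exact hc i
      · exact hc j
      · exact ((hball (hseg hp)).2 i j).le
    _ = _ := by ring

lemma locallyLipschitzOn_inChart {φ : M → ℝ} {K : NNReal} (hφ : LipschitzWith K φ) (c : M) :
    LocallyLipschitzOn (extChartAt (𝓡 n) c).target (inChart (n := n) c φ) := by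
  intro y hy
  obtain ⟨K', t, ht, h⟩ := locallyLipschitzOn_chart_symm (n := n) c hy
  exact ⟨K * K', t, ht, hφ.comp_lipschitzOnWith h⟩

/-- The differential of a `K`-Lipschitz function is bounded by `K`. -/
lemma abs_mvfderiv_le_of_lipschitzWith {φ : M → ℝ} {K : NNReal} (hφ : LipschitzWith K φ) (x : M)
    (X : TangentSpace (𝓡 n) x) : |mvfderiv (𝓡 n) φ x X| ≤ K * ‖X‖ := by
  by_cases hd : MDifferentiableAt (𝓡 n) 𝓘(ℝ, ℝ) φ x
  swap
  · rw [mvfderiv, mfderiv_zero_of_not_mdifferentiableAt hd]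
    refine le_of_eq_of_le ?_ (by positivity)
    exact abs_zero
  obtain ⟨c, y, hy, rfl⟩ : ∃ c, ∃ y ∈ (extChartAt (𝓡 n) c).target,
      (extChartAt (𝓡 n) c).symm y = x :=
    ⟨x, _, mem_extChartAt_target x, extChartAt_to_inv x⟩
  obtain ⟨v, rfl, -⟩ := exists_eq_sum_coordField hy X
  rw [mdifferentiableAt_iff_inChart hy] at hd
  rw [mvfderiv_mfderiv_chart_symm hy]
  set N : ℝ := ‖mfderiv (𝓡 n) (𝓡 n) (extChartAt (𝓡 n) c).symm y v‖ with hN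
  have hU := (isOpen_extChartAt_target (I := 𝓡 n) c).mem_nhds hy
  -- Bound the difference quotient along `y + t v`: for small `t > 0` the image of the segment has
  -- length at most `t (N + ε)`, by continuity of the metric.
  have key : ∀ ε > 0, |fderiv ℝ (inChart c φ) y v| ≤ K * (N + ε) := by
    intro ε hε
    have hN0 : 0 ≤ N := norm_nonneg _
    have hq : ContinuousAt (fun z ↦ ∑ i, ∑ j, v i * v j * metricMatrix c z i j) y :=
      tendsto_finsetSum _ fun i _ ↦ tendsto_finsetSum _ fun j _ ↦
        ((contDiffOn_metricMatrix c i j).continuousOn.continuousAt hU).const_mul _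
    have hev : ∀ᶠ z in nhds y,
        ‖mfderiv (𝓡 n) (𝓡 n) (extChartAt (𝓡 n) c).symm z v‖ ≤ N + ε := by
      have h1 : ∑ i, ∑ j, v i * v j * metricMatrix c y i j < (N + ε) ^ 2 := by
        rw [← norm_mfderiv_chart_symm_sq, ← hN]
        nlinarith
      filter_upwards [hq.eventually (gt_mem_nhds h1)] with z hz
      rw [← norm_mfderiv_chart_symm_sq] at hz
      exact (abs_le_of_sq_le_sq' hz.le (by positivity)).2
    obtain ⟨r, hr, hball⟩ := Metric.mem_nhds_iff.1 (Filter.inter_mem hU hev)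
    have hlim := (hd.hasFDerivAt.hasLineDerivAt v).tendsto_slope_zero_right.abs
    refine le_of_tendsto hlim ?_
    have hcont : Filter.Tendsto (fun t : ℝ ↦ y + t • v) (nhdsWithin 0 (Set.Ioi 0)) (nhds y) := by
      have : Continuous fun t : ℝ ↦ y + t • v := by fun_prop
      simpa using this.continuousAt.tendsto.mono_left (nhdsWithin_le_nhds (a := (0 : ℝ)))
    filter_upwards [hcont (Metric.ball_mem_nhds y hr), self_mem_nhdsWithin] with t ht ht0
    have ht0' : 0 < t := ht0
    have hseg : segment ℝ y (y + t • v) ⊆ Metric.ball y r :=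
      (convex_ball y r).segment_subset (Metric.mem_ball_self hr) ht
    have hdist : dist ((extChartAt (𝓡 n) c).symm y) ((extChartAt (𝓡 n) c).symm (y + t • v))
        ≤ t * (N + ε) := by
      refine dist_chart_symm_le (hseg.trans fun p hp ↦ (hball hp).1) fun p hp ↦ ?_
      have h2 : mfderiv (𝓡 n) (𝓡 n) (extChartAt (𝓡 n) c).symm p (y + t • v - y)
          = t • mfderiv (𝓡 n) (𝓡 n) (extChartAt (𝓡 n) c).symm p v := by
        rw [add_sub_cancel_left]
        exact map_smul (mfderiv (𝓡 n) (𝓡 n) (extChartAt (𝓡 n) c).symm p) t v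
      rw [h2, norm_smul, Real.norm_of_nonneg ht0'.le]
      exact mul_le_mul_of_nonneg_left (hball (hseg hp)).2 ht0'.le
    rw [smul_eq_mul, abs_mul, abs_inv, abs_of_pos ht0', inv_mul_le_iff₀ ht0']
    have h3 := hφ.dist_le_mul ((extChartAt (𝓡 n) c).symm (y + t • v))
      ((extChartAt (𝓡 n) c).symm y)
    rw [Real.dist_eq, dist_comm] at h3
    calc _ ≤ _ := h3
      _ ≤ K * (t * (N + ε)) := by gcongr
      _ = _ := by ring
  refine le_of_forall_pos_le_add fun ε hε ↦ ?_
  have hK : (0 : ℝ) < K + 1 := by positivity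
  -- Dividing by `K + 1` instead of `K` covers `K = 0`.
  refine (key (ε / (K + 1)) (by positivity)).trans ?_
  rw [mul_add]
  gcongr
  rw [mul_div_assoc', div_le_iff₀ hK]
  nlinarith

end RiemannianDistance

/-- A complete Riemannian manifold is proper. -/
theorem properSpace_of_isRiemannianManifold (n : ℕ) (M : Type*) [MetricSpace M]
    [ChartedSpace (EuclideanSpace ℝ (Fin n)) M]
    [RiemannianBundle (fun x : M ↦ TangentSpace (𝓡 n) x)] [IsRiemannianManifold (𝓡 n) M]
    [IsManifold (𝓡 n) ∞ M] [CompleteSpace M] : ProperSpace M := by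
  have : LocallyCompactSpace M := Manifold.locallyCompact_of_finiteDimensional (𝓡 n)
  exact properSpace_of_exists_dist_lt (exists_dist_le_dist_lt n)

/-! ### The volume measure and changes of charts. -/

section Volume

lemma measurableSet_inter_preimage_of_continuousOn {α β : Type*} [TopologicalSpace α]
    [MeasurableSpace α] [BorelSpace α] [TopologicalSpace β] [MeasurableSpace β] [BorelSpace β]
    {g : α → β} {t : Set α} (ht : MeasurableSet t) (hg : ContinuousOn g t) {A : Set β}
    (hA : MeasurableSet A) : MeasurableSet (t ∩ g ⁻¹' A) := by
  have h := ht.subtype_image (hg.domRestrict.measurable hA)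
  convert h using 1
  ext x
  simp [and_comm]

variable {n : ℕ} {M : Type*} [TopologicalSpace M] [ChartedSpace (EuclideanSpace ℝ (Fin n)) M]

lemma contDiffOn_transition [IsManifold (𝓡 n) ∞ M] (c c' : M) :
    ContDiffOn ℝ ∞ (extChartAt (𝓡 n) c' ∘ (extChartAt (𝓡 n) c).symm)
      ((extChartAt (𝓡 n) c).target ∩
        (extChartAt (𝓡 n) c).symm ⁻¹' (extChartAt (𝓡 n) c').source) := by
  rw [← contMDiffOn_iff_contDiffOn]
  exact (contMDiffOn_extChartAt (x := c')).comp
    ((contMDiffOn_chart_symm c).mono Set.inter_subset_left) fun y hy ↦ by simpa using hy.2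

lemma isOpen_overlap (c c' : M) :
    IsOpen ((extChartAt (𝓡 n) c).target ∩
      (extChartAt (𝓡 n) c).symm ⁻¹' (extChartAt (𝓡 n) c').source) :=
  (continuousOn_extChartAt_symm c).isOpen_inter_preimage (isOpen_extChartAt_target c)
    (isOpen_extChartAt_source c')

variable [RiemannianBundle (fun x : M ↦ TangentSpace (𝓡 n) x)]

/-- All tangent spaces are the same type `ℝⁿ`, and only the inner product depends on the base point;
this moves it between points that are equal but given by different expressions. -/
lemma inner_tangentSpace_congr {x x' : M} (h : x = x') {v w : TangentSpace (𝓡 n) x}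
    {v' w' : TangentSpace (𝓡 n) x'} (hv : @Eq (EuclideanSpace ℝ (Fin n)) v v')
    (hw : @Eq (EuclideanSpace ℝ (Fin n)) w w') : inner ℝ v w = inner ℝ v' w' := by
  subst h
  exact congrArg₂ _ hv hw

/-- The transformation law of the metric under a change of charts. -/
lemma metricMatrix_transition [IsManifold (𝓡 n) ∞ M] {c c' : M} {y : EuclideanSpace ℝ (Fin n)}
    (hy : y ∈ (extChartAt (𝓡 n) c).target)
    (hy' : (extChartAt (𝓡 n) c).symm y ∈ (extChartAt (𝓡 n) c').source) :
    metricMatrix c y =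
      (LinearMap.toMatrix (EuclideanSpace.basisFun (Fin n) ℝ).toBasis
        (EuclideanSpace.basisFun (Fin n) ℝ).toBasis
        (fderiv ℝ (extChartAt (𝓡 n) c' ∘ (extChartAt (𝓡 n) c).symm) y).toLinearMap).transpose
      * metricMatrix c' (extChartAt (𝓡 n) c' ((extChartAt (𝓡 n) c).symm y))
      * LinearMap.toMatrix (EuclideanSpace.basisFun (Fin n) ℝ).toBasis
        (EuclideanSpace.basisFun (Fin n) ℝ).toBasis
        (fderiv ℝ (extChartAt (𝓡 n) c' ∘ (extChartAt (𝓡 n) c).symm) y).toLinearMap := by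
  set τ := extChartAt (𝓡 n) c' ∘ (extChartAt (𝓡 n) c).symm with hτ
  have hmem : τ y ∈ (extChartAt (𝓡 n) c').target := (extChartAt (𝓡 n) c').map_source hy'
  have hU := (isOpen_overlap (n := n) c c').mem_nhds ⟨hy, hy'⟩
  have hτd : DifferentiableAt ℝ τ y :=
    ((contDiffOn_transition c c').contDiffAt hU).differentiableAt (by simp)
  have heq : (extChartAt (𝓡 n) c).symm =ᶠ[nhds y] (extChartAt (𝓡 n) c').symm ∘ τ := by
    filter_upwards [hU] with z hz
    exact ((extChartAt (𝓡 n) c').left_inv hz.2).symm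
  have hcomp : mfderiv (𝓡 n) (𝓡 n) ((extChartAt (𝓡 n) c').symm ∘ τ) y
      = (mfderiv (𝓡 n) (𝓡 n) (extChartAt (𝓡 n) c').symm (τ y)).comp (mfderiv (𝓡 n) (𝓡 n) τ y) :=
    mfderiv_comp y (mdifferentiableAt_chart_symm hmem) hτd.mdifferentiableAt
  have hcf : ∀ i, (coordField c y i : EuclideanSpace ℝ (Fin n))
      = mfderiv (𝓡 n) (𝓡 n) (extChartAt (𝓡 n) c').symm (τ y)
          (fderiv ℝ τ y (EuclideanSpace.single i 1)) := by
    intro i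
    have h1 : mfderiv (𝓡 n) (𝓡 n) τ y = fderiv ℝ τ y := mfderiv_eq_fderiv
    rw [coordField, heq.mfderiv_eq, hcomp, h1]
    rfl
  have hbase : (extChartAt (𝓡 n) c).symm y = (extChartAt (𝓡 n) c').symm (τ y) :=
    ((extChartAt (𝓡 n) c').left_inv hy').symm
  ext i j
  have h2 : metricMatrix c y i j = inner ℝ
      (mfderiv (𝓡 n) (𝓡 n) (extChartAt (𝓡 n) c').symm (τ y)
          (fderiv ℝ τ y (EuclideanSpace.single i 1)))
      (mfderiv (𝓡 n) (𝓡 n) (extChartAt (𝓡 n) c').symm (τ y)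
          (fderiv ℝ τ y (EuclideanSpace.single j 1))) :=
    inner_tangentSpace_congr hbase (hcf i) (hcf j)
  rw [h2, inner_mfderiv_chart_symm]
  simp only [Matrix.mul_apply, Matrix.transpose_apply, LinearMap.toMatrix_apply, Finset.sum_mul,
    OrthonormalBasis.coe_toBasis, EuclideanSpace.basisFun_apply,
    OrthonormalBasis.coe_toBasis_repr_apply, EuclideanSpace.basisFun_repr,
    ContinuousLinearMap.coe_coe]
  rw [Finset.sum_comm]
  refine Finset.sum_congr rfl fun a _ ↦ Finset.sum_congr rfl fun b _ ↦ ?_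
  change _ = _ * metricMatrix c' (τ y) b a * _
  ring

lemma sqrt_det_metricMatrix_transition [IsManifold (𝓡 n) ∞ M] {c c' : M}
    {y : EuclideanSpace ℝ (Fin n)} (hy : y ∈ (extChartAt (𝓡 n) c).target)
    (hy' : (extChartAt (𝓡 n) c).symm y ∈ (extChartAt (𝓡 n) c').source) :
    √(metricMatrix c y).det =
      |(fderiv ℝ (extChartAt (𝓡 n) c' ∘ (extChartAt (𝓡 n) c).symm) y).det|
        * √(metricMatrix c' (extChartAt (𝓡 n) c' ((extChartAt (𝓡 n) c).symm y))).det := by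
  rw [metricMatrix_transition hy hy', Matrix.det_mul, Matrix.det_mul, Matrix.det_transpose,
    LinearMap.det_toMatrix, mul_right_comm, Real.sqrt_mul (mul_self_nonneg _),
    Real.sqrt_mul_self_eq_abs]

variable [MeasurableSpace M] [BorelSpace M]

lemma aemeasurable_chart_symm (c : M) : AEMeasurable (extChartAt (𝓡 n) c).symm
    ((volume.restrict (extChartAt (𝓡 n) c).target).withDensity
      fun y : EuclideanSpace ℝ (Fin n) ↦ ENNReal.ofReal √(metricMatrix c y).det) :=
  ((continuousOn_extChartAt_symm c).aemeasurable
    (isOpen_extChartAt_target c).measurableSet).mono_ac (withDensity_absolutelyContinuous _ _)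

lemma chartVolume_apply (c : M) {A : Set M} (hA : MeasurableSet A) :
    chartVolume n c A = ∫⁻ y in (extChartAt (𝓡 n) c).target ∩ (extChartAt (𝓡 n) c).symm ⁻¹' A,
      ENNReal.ofReal √(metricMatrix c y).det := by
  rw [chartVolume, Measure.map_apply_of_aemeasurable (aemeasurable_chart_symm c) hA,
    withDensity_apply', Measure.restrict_restrict' (isOpen_extChartAt_target c).measurableSet,
    Set.inter_comm]

/-- Change of variables along the transition map: its Jacobian is exactly the ratio of the densities
`√(det g)`. -/
lemma chartVolume_eq_of_subset [IsManifold (𝓡 n) ∞ M] {c c' : M} {A : Set M} (hA : MeasurableSet A)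
    (hc : A ⊆ (extChartAt (𝓡 n) c).source) (hc' : A ⊆ (extChartAt (𝓡 n) c').source) :
    chartVolume n c A = chartVolume n c' A := by
  set τ := extChartAt (𝓡 n) c' ∘ (extChartAt (𝓡 n) c).symm with hτ
  set S := (extChartAt (𝓡 n) c).target ∩ (extChartAt (𝓡 n) c).symm ⁻¹' A with hS
  have hSm : MeasurableSet S := measurableSet_inter_preimage_of_continuousOn
    (isOpen_extChartAt_target c).measurableSet (continuousOn_extChartAt_symm c) hA
  have himg : (extChartAt (𝓡 n) c').target ∩ (extChartAt (𝓡 n) c').symm ⁻¹' A = τ '' S := by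
    ext z
    constructor
    · rintro ⟨hz, hzA⟩
      refine ⟨extChartAt (𝓡 n) c ((extChartAt (𝓡 n) c').symm z),
        ⟨(extChartAt (𝓡 n) c).map_source (hc hzA), ?_⟩, ?_⟩
      · rw [Set.mem_preimage, (extChartAt (𝓡 n) c).left_inv (hc hzA)]
        exact hzA
      · rw [hτ, Function.comp_apply, (extChartAt (𝓡 n) c).left_inv (hc hzA),
          (extChartAt (𝓡 n) c').right_inv hz]
    · rintro ⟨y, ⟨hy, hyA⟩, rfl⟩
      refine ⟨(extChartAt (𝓡 n) c').map_source (hc' hyA), ?_⟩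
      rw [Set.mem_preimage, hτ, Function.comp_apply, (extChartAt (𝓡 n) c').left_inv (hc' hyA)]
      exact hyA
  have hinj : Set.InjOn τ S := fun y hy z hz h ↦
    (extChartAt (𝓡 n) c).symm.injOn hy.1 hz.1
      ((extChartAt (𝓡 n) c').injOn (hc' hy.2) (hc' hz.2) h)
  have hder : ∀ y ∈ S, HasFDerivWithinAt τ (fderiv ℝ τ y) S y := fun y hy ↦
    (((contDiffOn_transition c c').contDiffAt ((isOpen_overlap (n := n) c c').mem_nhds
      ⟨hy.1, hc' hy.2⟩)).differentiableAt (by simp)).hasFDerivAt.hasFDerivWithinAt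
  rw [chartVolume_apply c hA, chartVolume_apply c' hA, himg,
    lintegral_image_eq_lintegral_abs_det_fderiv_mul volume hSm hder hinj]
  refine setLIntegral_congr_fun hSm fun y hy ↦ ?_
  rw [sqrt_det_metricMatrix_transition hy.1 (hc' hy.2), ENNReal.ofReal_mul (abs_nonneg _)]
  rfl

/-- The supremum dominates `chartVolume n c` by definition. The converse needs a measure above all
chart volumes that adds nothing on the domain of the chart. -/
lemma riemannianVolume_restrict_source [IsManifold (𝓡 n) ∞ M] (c : M) :
    (riemannianVolume n M).restrict (extChartAt (𝓡 n) c).source = chartVolume n c := by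
  have hsm : MeasurableSet (extChartAt (𝓡 n) c).source :=
    (isOpen_extChartAt_source c).measurableSet
  have hcompl : ∀ c : M, chartVolume n c (extChartAt (𝓡 n) c).sourceᶜ = 0 := by
    intro c
    rw [chartVolume_apply c (isOpen_extChartAt_source c).measurableSet.compl]
    have : (extChartAt (𝓡 n) c).target ∩ (extChartAt (𝓡 n) c).symm ⁻¹'
        (extChartAt (𝓡 n) c).sourceᶜ = ∅ := by
      ext y
      simp only [Set.mem_inter_iff, Set.mem_preimage, Set.mem_compl_iff, Set.mem_empty_iff_false,
        iff_false, not_and, not_not]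
      exact fun hy ↦ (extChartAt (𝓡 n) c).map_target hy
    rw [this, Measure.restrict_empty, lintegral_zero_measure]
  have hinter : ∀ (c : M) {A : Set M}, MeasurableSet A →
      chartVolume n c A = chartVolume n c (A ∩ (extChartAt (𝓡 n) c).source) := by
    intro c A hA
    exact (measure_inter_conull (hcompl c)).symm
  ext A hA
  rw [Measure.restrict_apply hA, hinter c hA]
  refine le_antisymm ?_ (Measure.le_iff'.1 (le_iSup (fun c : M ↦ chartVolume n c) c) _)
  -- Infinite mass at each point off the domain makes domination trivial for sets that leave it; for
  -- sets inside, chart volumes agree on overlaps.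
  set ν : Measure M := chartVolume n c
    + (⊤ : ℝ≥0∞) • (Measure.count.restrict (extChartAt (𝓡 n) c).sourceᶜ) with hν
  have hle : riemannianVolume n M ≤ ν := by
    refine iSup_le fun c' ↦ Measure.le_iff.2 fun B hB ↦ ?_
    by_cases hBs : B ⊆ (extChartAt (𝓡 n) c).source
    · have h1 : chartVolume n c' B = chartVolume n c (B ∩ (extChartAt (𝓡 n) c').source) := by
        rw [hinter c' hB]
        exact chartVolume_eq_of_subset (hB.inter (isOpen_extChartAt_source c').measurableSet)
          Set.inter_subset_right (Set.inter_subset_left.trans hBs)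
      rw [h1, hν, Measure.add_apply]
      exact (measure_mono Set.inter_subset_left).trans le_self_add
    · obtain ⟨p, hpB, hp⟩ := Set.not_subset.1 hBs
      have h2 : Measure.count.restrict (extChartAt (𝓡 n) c).sourceᶜ B ≠ 0 := by
        rw [Measure.restrict_apply hB]
        exact Measure.count_ne_zero ⟨p, hpB, hp⟩
      rw [hν, Measure.add_apply, Measure.smul_apply, smul_eq_mul, ENNReal.top_mul h2, add_top]
      exact le_top
  refine (Measure.le_iff'.1 hle _).trans_eq ?_
  rw [hν, Measure.add_apply, Measure.smul_apply, Measure.restrict_apply (hA.inter hsm),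
    Set.inter_assoc, Set.inter_compl_self, Set.inter_empty, measure_empty, smul_zero, add_zero]

end Volume

/-! ### Passing between integrals on `M` and in a chart. -/

section Transfer

lemma map_withDensity_comp {α β : Type*} [MeasurableSpace α] [MeasurableSpace β] {ν : Measure α}
    [SFinite ν] {g : α → β} (hg : AEMeasurable g ν) {e : β → ℝ≥0∞} (he : Measurable e) :
    (ν.map g).withDensity e = (ν.withDensity (e ∘ g)).map g := by
  ext A hA
  rw [withDensity_apply _ hA, Measure.restrict_map_of_aemeasurable hg hA,
    lintegral_map' he.aemeasurable (hg.mono_measure Measure.restrict_le_self),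
    Measure.map_apply_of_aemeasurable (hg.mono_ac (withDensity_absolutelyContinuous _ _)) hA,
    withDensity_apply']
  rfl

variable {n : ℕ} {M : Type*} [TopologicalSpace M] [ChartedSpace (EuclideanSpace ℝ (Fin n)) M]

lemma aestronglyMeasurable_of_chart [MeasurableSpace M] [BorelSpace M] {c : M} {F : M → ℝ}
    {H : EuclideanSpace ℝ (Fin n) → ℝ} (hH : Measurable H)
    (hF : ∀ y ∈ (extChartAt (𝓡 n) c).target, F ((extChartAt (𝓡 n) c).symm y) = H y)
    (h0 : ∀ x ∉ (extChartAt (𝓡 n) c).source, F x = 0) (μ : Measure M) :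
    AEStronglyMeasurable F μ := by
  have hsm : MeasurableSet (extChartAt (𝓡 n) c).source :=
    (isOpen_extChartAt_source c).measurableSet
  have h1 : F = (extChartAt (𝓡 n) c).source.indicator (H ∘ extChartAt (𝓡 n) c) := by
    ext x
    by_cases hx : x ∈ (extChartAt (𝓡 n) c).source
    · rw [Set.indicator_of_mem hx, Function.comp_apply,
        ← hF _ ((extChartAt (𝓡 n) c).map_source hx), (extChartAt (𝓡 n) c).left_inv hx]
    · rw [Set.indicator_of_notMem hx, h0 x hx]
  rw [h1]
  refine AEMeasurable.aestronglyMeasurable ((aemeasurable_indicator_iff hsm).2 ?_)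
  exact hH.comp_aemeasurable ((continuousOn_extChartAt c).aemeasurable hsm)

variable [RiemannianBundle (fun x : M ↦ TangentSpace (𝓡 n) x)]

/-- The density of the weighted volume in the chart around `c`. -/
def weightDensity (m : ℝ) (f : M → ℝ) (c : M) (y : EuclideanSpace ℝ (Fin n)) : ℝ :=
  √(metricMatrix c y).det * Real.exp (-inChart c f y / m)

lemma weightDensity_nonneg (m : ℝ) (f : M → ℝ) (c : M) (y : EuclideanSpace ℝ (Fin n)) :
    0 ≤ weightDensity m f c y := by
  unfold weightDensity; positivity

variable [IsManifold (𝓡 n) ∞ M]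

lemma weightDensity_pos (m : ℝ) (f : M → ℝ) {c : M} {y : EuclideanSpace ℝ (Fin n)}
    (hy : y ∈ (extChartAt (𝓡 n) c).target) : 0 < weightDensity m f c y :=
  mul_pos (Real.sqrt_pos.2 (det_metricMatrix_pos hy)) (Real.exp_pos _)

variable [IsContMDiffRiemannianBundle (𝓡 n) ∞ (EuclideanSpace ℝ (Fin n))
      (fun x : M ↦ TangentSpace (𝓡 n) x)]

lemma contDiffOn_weightDensity {f : M → ℝ} (hf : ContMDiff (𝓡 n) 𝓘(ℝ, ℝ) ∞ f) (m : ℝ) (c : M) :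
    ContDiffOn ℝ ∞ (weightDensity (n := n) m f c) (extChartAt (𝓡 n) c).target :=
  (contDiffOn_sqrt_det_metricMatrix c).mul (contDiffOn_weight hf m c)

variable [MeasurableSpace M] [BorelSpace M]

lemma weightedVolume_restrict_source {f : M → ℝ} (hf : ContMDiff (𝓡 n) 𝓘(ℝ, ℝ) ∞ f) (m : ℝ)
    (c : M) :
    (weightedVolume n m f).restrict (extChartAt (𝓡 n) c).source
      = ((volume.restrict (extChartAt (𝓡 n) c).target).withDensity
          fun y ↦ ENNReal.ofReal (weightDensity (n := n) m f c y)).map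
            (extChartAt (𝓡 n) c).symm := by
  have hmeas : Measurable fun x ↦ ENNReal.ofReal (Real.exp (-f x / m)) :=
    (Real.continuous_exp.comp (hf.continuous.neg.div_const m)).measurable.ennreal_ofReal
  have htm := (isOpen_extChartAt_target (I := 𝓡 n) c).measurableSet
  rw [weightedVolume, restrict_withDensity (isOpen_extChartAt_source c).measurableSet,
    riemannianVolume_restrict_source, chartVolume,
    map_withDensity_comp (aemeasurable_chart_symm c) hmeas, ← withDensity_mul₀]
  · congr 2
    ext y
    rw [Pi.mul_apply, weightDensity, ENNReal.ofReal_mul (Real.sqrt_nonneg _)]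
    rfl
  · exact ((contDiffOn_sqrt_det_metricMatrix c).continuousOn.aemeasurable htm).ennreal_ofReal
  · exact ((contDiffOn_weight hf m c).continuousOn.aemeasurable htm).ennreal_ofReal

lemma integral_weightedVolume_chart {f : M → ℝ} (hf : ContMDiff (𝓡 n) 𝓘(ℝ, ℝ) ∞ f) (m : ℝ)
    {c : M} {F : M → ℝ} (hF : AEStronglyMeasurable F (weightedVolume n m f))
    (h0 : ∀ x ∉ (extChartAt (𝓡 n) c).source, F x = 0) :
    ∫ x, F x ∂(weightedVolume n m f)
      = ∫ y in (extChartAt (𝓡 n) c).target,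
          weightDensity m f c y * F ((extChartAt (𝓡 n) c).symm y) := by
  have htm := (isOpen_extChartAt_target (I := 𝓡 n) c).measurableSet
  have hw := ((contDiffOn_weightDensity hf m c).continuousOn.aemeasurable htm
    (μ := volume)).ennreal_ofReal
  have hF' := hF.restrict (s := (extChartAt (𝓡 n) c).source)
  rw [← setIntegral_eq_integral_of_forall_compl_eq_zero h0]
  rw [weightedVolume_restrict_source hf] at hF' ⊢
  rw [integral_map _ hF', integral_withDensity_eq_integral_toReal_smul₀ hw]
  · simp [ENNReal.toReal_ofReal (weightDensity_nonneg _ _ _ _)]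
  · simp
  · exact ((continuousOn_extChartAt_symm c).aemeasurable htm).mono_ac
      (withDensity_absolutelyContinuous _ _)

lemma integrable_weightedVolume_chart {f : M → ℝ} (hf : ContMDiff (𝓡 n) 𝓘(ℝ, ℝ) ∞ f) (m : ℝ)
    {c : M} {F : M → ℝ} (hF : AEStronglyMeasurable F (weightedVolume n m f))
    (h0 : ∀ x ∉ (extChartAt (𝓡 n) c).source, F x = 0)
    (hint : IntegrableOn (fun y ↦ weightDensity m f c y * F ((extChartAt (𝓡 n) c).symm y))
      (extChartAt (𝓡 n) c).target) :
    Integrable F (weightedVolume n m f) := by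
  have htm := (isOpen_extChartAt_target (I := 𝓡 n) c).measurableSet
  have hw := ((contDiffOn_weightDensity hf m c).continuousOn.aemeasurable htm
    (μ := volume)).ennreal_ofReal
  have hF' := hF.restrict (s := (extChartAt (𝓡 n) c).source)
  have hsupp : Function.support F ⊆ (extChartAt (𝓡 n) c).source := fun x hx ↦ by
    by_contra h; exact hx (h0 x h)
  rw [← integrableOn_iff_integrable_of_support_subset hsupp, IntegrableOn]
  rw [weightedVolume_restrict_source hf] at hF' ⊢
  rw [integrable_map_measure hF', integrable_withDensity_iff_integrable_smul₀' hw]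
  · rw [IntegrableOn] at hint
    simpa [ENNReal.toReal_ofReal (weightDensity_nonneg _ _ _ _)] using hint
  · simp
  · exact ((continuousOn_extChartAt_symm c).aemeasurable htm).mono_ac
      (withDensity_absolutelyContinuous _ _)

/-- A property that holds off the domain of a chart, and almost everywhere in the chart, holds
almost everywhere for the weighted volume. -/
lemma ae_weightedVolume_of_chart {f : M → ℝ} (hf : ContMDiff (𝓡 n) 𝓘(ℝ, ℝ) ∞ f) (m : ℝ)
    {c : M} {p : M → Prop} (h0 : ∀ x ∉ (extChartAt (𝓡 n) c).source, p x)
    (h : ∀ᵐ y, y ∈ (extChartAt (𝓡 n) c).target → p ((extChartAt (𝓡 n) c).symm y)) :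
    ∀ᵐ x ∂(weightedVolume n m f), p x := by
  have htm := (isOpen_extChartAt_target (I := 𝓡 n) c).measurableSet
  obtain ⟨N, hN, hNm, hN0⟩ := exists_measurable_superset_of_null (ae_iff.1 h)
  set A : Set M := (extChartAt (𝓡 n) c).source ∩ extChartAt (𝓡 n) c ⁻¹' N
  have hA : MeasurableSet A := measurableSet_inter_preimage_of_continuousOn
    (isOpen_extChartAt_source c).measurableSet (continuousOn_extChartAt c) hNm
  refine measure_mono_null (t := A) (fun x hx ↦ ?_) ?_
  · have hxs : x ∈ (extChartAt (𝓡 n) c).source := by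
      by_contra hxs
      exact hx (h0 x hxs)
    refine ⟨hxs, hN ?_⟩
    simp only [Set.mem_ofPred_eq, Classical.not_imp]
    exact ⟨(extChartAt (𝓡 n) c).map_source hxs, by rwa [(extChartAt (𝓡 n) c).left_inv hxs]⟩
  · rw [← Measure.restrict_eq_self _ (Set.inter_subset_left : A ⊆ (extChartAt (𝓡 n) c).source),
      weightedVolume_restrict_source hf, Measure.map_apply_of_aemeasurable
        (((continuousOn_extChartAt_symm c).aemeasurable htm).mono_ac
          (withDensity_absolutelyContinuous _ _)) hA]
    refine withDensity_absolutelyContinuous _ _ ?_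
    rw [Measure.restrict_apply' htm]
    refine measure_mono_null (fun y hy ↦ ?_) hN0
    have := hy.1.2
    rwa [Set.mem_preimage, (extChartAt (𝓡 n) c).right_inv hy.2] at this

end Transfer

/-! ### Integration by parts in one chart. -/

section IntegrationByParts

lemma exists_lipschitzOnWith_mul {α : Type*} [PseudoMetricSpace α] {u v : α → ℝ} {y : α}
    (hu : ∃ K, ∃ t ∈ nhds y, LipschitzOnWith K u t)
    (hv : ∃ K, ∃ t ∈ nhds y, LipschitzOnWith K v t) :
    ∃ K, ∃ t ∈ nhds y, LipschitzOnWith K (fun z ↦ u z * v z) t := by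
  obtain ⟨K, s, hs, hus⟩ := hu
  obtain ⟨L, t, ht, hvt⟩ := hv
  have hmul : LocallyLipschitz fun p : ℝ × ℝ ↦ p.1 * p.2 :=
    ContDiff.locallyLipschitz (𝕂 := ℝ) (contDiff_fst.mul contDiff_snd)
  obtain ⟨C, r, hr, hC⟩ := hmul (u y, v y)
  have hp : LipschitzOnWith (max K L) (fun z ↦ (u z, v z)) (s ∩ t) :=
    (hus.mono Set.inter_subset_left).prodMk (hvt.mono Set.inter_subset_right)
  have hst := Filter.inter_mem hs ht
  have hc : ContinuousAt (fun z ↦ (u z, v z)) y := hp.continuousOn.continuousAt hst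
  exact ⟨C * max K L, _, Filter.inter_mem hst (hc hr),
    hC.comp (hp.mono Set.inter_subset_left) fun z hz ↦ hz.2⟩

lemma exists_lipschitzOnWith_of_contDiffOn {n : ℕ} {u : EuclideanSpace ℝ (Fin n) → ℝ}
    {s : Set (EuclideanSpace ℝ (Fin n))} (hs : IsOpen s) (hu : ContDiffOn ℝ ∞ u s)
    {y : EuclideanSpace ℝ (Fin n)} (hy : y ∈ s) : ∃ K, ∃ t ∈ nhds y, LipschitzOnWith K u t :=
  ((hu.contDiffAt (hs.mem_nhds hy)).of_le (by simp)).exists_lipschitzOnWith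

variable {n : ℕ} {M : Type*} [TopologicalSpace M]
  [ChartedSpace (EuclideanSpace ℝ (Fin n)) M]

/-- The functions on `M` that are Lipschitz in the chart around `c` and compactly supported in its
domain. -/
structure IsChartTest (c : M) (ψ : M → ℝ) : Prop where
  compact : IsCompact (tsupport ψ)
  subset : tsupport ψ ⊆ (extChartAt (𝓡 n) c).source
  lipschitz : LocallyLipschitzOn (extChartAt (𝓡 n) c).target (inChart (n := n) c ψ)

lemma IsChartTest.eq_zero {c : M} {ψ : M → ℝ} (hψ : IsChartTest (n := n) c ψ) {x : M}
    (hx : x ∉ (extChartAt (𝓡 n) c).source) : ψ x = 0 :=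
  image_eq_zero_of_notMem_tsupport fun h ↦ hx (hψ.subset h)

/-- Here `h` is controlled only on the target of the chart. The support of `ψ` has compact image in
this open set, so the extension by zero stays locally Lipschitz across the boundary. -/
lemma IsChartTest.mul_contDiffOn {c : M} {ψ : M → ℝ} (hψ : IsChartTest (n := n) c ψ)
    {h : EuclideanSpace ℝ (Fin n) → ℝ} (hh : ContDiffOn ℝ ∞ h (extChartAt (𝓡 n) c).target) :
    LocallyLipschitz ((extChartAt (𝓡 n) c).target.indicator fun y ↦ inChart c ψ y * h y) ∧
    HasCompactSupport ((extChartAt (𝓡 n) c).target.indicator fun y ↦ inChart c ψ y * h y) ∧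
    tsupport ((extChartAt (𝓡 n) c).target.indicator fun y ↦ inChart c ψ y * h y)
      ⊆ (extChartAt (𝓡 n) c).target := by
  set F := (extChartAt (𝓡 n) c).target.indicator fun y ↦ inChart c ψ y * h y with hF
  set K := extChartAt (𝓡 n) c '' tsupport ψ with hK
  have hKc : IsCompact K :=
    hψ.compact.image_of_continuousOn ((continuousOn_extChartAt c).mono hψ.subset)
  have hKt : K ⊆ (extChartAt (𝓡 n) c).target := by
    rintro _ ⟨x, hx, rfl⟩
    exact (extChartAt (𝓡 n) c).map_source (hψ.subset hx)
  have h0 : ∀ y ∉ K, F y = 0 := by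
    intro y hy
    by_cases hyt : y ∈ (extChartAt (𝓡 n) c).target
    · rw [hF, Set.indicator_of_mem hyt, inChart,
        image_eq_zero_of_notMem_tsupport (f := ψ) fun hmem ↦
          hy ⟨_, hmem, (extChartAt (𝓡 n) c).right_inv hyt⟩, zero_mul]
    · rw [hF, Set.indicator_of_notMem hyt]
  have hsub : tsupport F ⊆ K :=
    closure_minimal (fun y hy ↦ by by_contra h; exact hy (h0 y h)) hKc.isClosed
  refine ⟨fun y ↦ ?_, hKc.of_isClosed_subset (isClosed_tsupport F) hsub, hsub.trans hKt⟩
  by_cases hyt : y ∈ (extChartAt (𝓡 n) c).target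
  · have hU := (isOpen_extChartAt_target (I := 𝓡 n) c).mem_nhds hyt
    obtain ⟨L, t, ht, hL⟩ := hψ.lipschitz hyt
    rw [nhdsWithin_eq_nhds.2 hU] at ht
    obtain ⟨C, s, hs, hC⟩ := exists_lipschitzOnWith_mul ⟨L, t, ht, hL⟩
      (exists_lipschitzOnWith_of_contDiffOn (isOpen_extChartAt_target c) hh hyt)
    refine ⟨C, s ∩ (extChartAt (𝓡 n) c).target, Filter.inter_mem hs hU, ?_⟩
    intro a ha b hb
    rw [hF, Set.indicator_of_mem ha.2, Set.indicator_of_mem hb.2]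
    exact hC ha.1 hb.1
  · refine ⟨0, Kᶜ, hKc.isClosed.isOpen_compl.mem_nhds fun h ↦ hyt (hKt h), ?_⟩
    intro a ha b hb
    rw [h0 a ha, h0 b hb]
    simp

lemma IsChartTest.ae_differentiableAt {c : M} {ψ : M → ℝ} (hψ : IsChartTest (n := n) c ψ) :
    ∀ᵐ y, y ∈ (extChartAt (𝓡 n) c).target → DifferentiableAt ℝ (inChart (n := n) c ψ) y := by
  obtain ⟨h1, h2, -⟩ := hψ.mul_contDiffOn (contDiffOn_const (c := (1 : ℝ)))
  filter_upwards [ae_differentiableAt_of_locallyLipschitz h1 h2] with y hy hyt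
  refine hy.congr_of_eventuallyEq ?_
  filter_upwards [(isOpen_extChartAt_target (I := 𝓡 n) c).mem_nhds hyt] with z hz
  rw [Set.indicator_of_mem hz, mul_one]

variable [RiemannianBundle (fun x : M ↦ TangentSpace (𝓡 n) x)] [IsManifold (𝓡 n) ∞ M]
  [IsContMDiffRiemannianBundle (𝓡 n) ∞ (EuclideanSpace ℝ (Fin n))
      (fun x : M ↦ TangentSpace (𝓡 n) x)] [MeasurableSpace M] [BorelSpace M]
  {f : M → ℝ}

lemma IsChartTest.ae_mdifferentiableAt (hf : ContMDiff (𝓡 n) 𝓘(ℝ, ℝ) ∞ f) (m : ℝ)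
    {c : M} {ψ : M → ℝ} (hψ : IsChartTest (n := n) c ψ) :
    ∀ᵐ x ∂(weightedVolume n m f), MDifferentiableAt (𝓡 n) 𝓘(ℝ, ℝ) ψ x := by
  refine ae_weightedVolume_of_chart hf m (c := c) (fun x hx ↦ ?_) ?_
  · have h0 : ψ =ᶠ[nhds x] fun _ ↦ 0 := notMem_tsupport_iff_eventuallyEq.1 fun h ↦ hx (hψ.subset h)
    exact mdifferentiableAt_const.congr_of_eventuallyEq h0
  · filter_upwards [hψ.ae_differentiableAt] with y hy hyt
    exact (mdifferentiableAt_iff_inChart hyt ψ).2 (hy hyt)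

/-- Directional derivatives given by `fderiv` are measurable for any function, so only the
coefficients, continuous on the target and extended by zero, need care. -/
lemma IsChartTest.aestronglyMeasurable_gradDeriv (hf : ContMDiff (𝓡 n) 𝓘(ℝ, ℝ) ∞ f)
    {c : M} {ψ : M → ℝ} (hψ : IsChartTest (n := n) c ψ) (μ : Measure M) :
    AEStronglyMeasurable (gradDeriv n f ψ) μ := by
  classical
  set a : Fin n → Fin n → EuclideanSpace ℝ (Fin n) → ℝ := fun i j ↦
    (extChartAt (𝓡 n) c).target.piecewise
      (fun y ↦ (metricMatrix c y)⁻¹ i j * partialDeriv j (inChart c f) y) 0 with ha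
  refine aestronglyMeasurable_of_chart (c := c)
    (H := fun y ↦ ∑ i, ∑ j, a i j y * partialDeriv i (inChart c ψ) y) ?_ (fun y hy ↦ ?_)
    (fun x hx ↦ ?_) μ
  · refine Finset.measurable_sum _ fun i _ ↦ Finset.measurable_sum _ fun j _ ↦ ?_
    refine Measurable.mul ?_ (measurable_fderiv_apply_const ℝ _ _)
    refine ContinuousOn.measurable_piecewise ?_ continuousOn_const
      (isOpen_extChartAt_target c).measurableSet
    exact ((contDiffOn_metricMatrix_inv c i j).mul (contDiffOn_partialDeriv
      (isOpen_extChartAt_target c) (contDiffOn_inChart hf c) j)).continuousOn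
  · rw [gradDeriv_chart hy]
    simp only [ha, Set.piecewise_eq_of_mem _ _ _ hy]
  · exact gradDeriv_eq_zero_of_eventuallyEq_const (a := 0)
      (notMem_tsupport_iff_eventuallyEq.1 fun h ↦ hx (hψ.subset h))

/-- Integration by parts in a chart. -/
theorem IsChartTest.integral_chart (hf : ContMDiff (𝓡 n) 𝓘(ℝ, ℝ) ∞ f) (m : ℝ)
    {c : M} {ψ : M → ℝ} (hψ : IsChartTest (n := n) c ψ) :
    Integrable (gradDeriv n f ψ) (weightedVolume n m f) ∧
    Integrable (fun x ↦ ψ x * chartWeightedLaplacian m f c (extChartAt (𝓡 n) c x))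
      (weightedVolume n m f) ∧
    ∫ x, ψ x * chartWeightedLaplacian m f c (extChartAt (𝓡 n) c x) ∂(weightedVolume n m f)
      = -∫ x, gradDeriv n f ψ x ∂(weightedVolume n m f) := by
  have hto := isOpen_extChartAt_target (I := 𝓡 n) c
  have htm := hto.measurableSet
  set L := chartWeightedLaplacian (n := n) m f c with hL
  set w := weightDensity (n := n) m f c with hw
  -- The components of `ψ √g e^{-f/m} ∇f`, extended by zero; the divergence of this field has
  -- integral zero.
  set F : Fin n → EuclideanSpace ℝ (Fin n) → ℝ := fun i ↦
    (extChartAt (𝓡 n) c).target.indicator fun y ↦ inChart c ψ y * weightedFlux m f c i y with hF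
  have hF1 := fun i ↦ hψ.mul_contDiffOn (contDiffOn_weightedFlux hf m c i)
  have hdivflux : ContDiffOn ℝ ∞ (fun y ↦ ∑ i, partialDeriv i (weightedFlux (n := n) m f c i) y)
      (extChartAt (𝓡 n) c).target := ContDiffOn.sum fun i _ ↦
    contDiffOn_partialDeriv hto (contDiffOn_weightedFlux hf m c i) i
  obtain ⟨hQ1, hQ2, -⟩ := hψ.mul_contDiffOn hdivflux
  have hQint := (hQ1.continuous.integrable_of_hasCompactSupport hQ2 (μ := volume)).integrableOn
    (s := (extChartAt (𝓡 n) c).target)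
  have hA : IntegrableOn (fun y ↦ w y * (inChart c ψ y * L y)) (extChartAt (𝓡 n) c).target := by
    refine hQint.congr_fun (fun y hy ↦ ?_) htm
    rw [Set.indicator_of_mem hy, sum_partialDeriv_weightedFlux hf m hy, hw, weightDensity]
    ring
  have hDint : Integrable fun y ↦ ∑ i, partialDeriv i (F i) y :=
    integrable_finsetSum _ fun i _ ↦
      integrable_partialDeriv_of_locallyLipschitz (hF1 i).1 (hF1 i).2.1 i
  have hD0 : ∫ y, ∑ i, partialDeriv i (F i) y = 0 := by
    rw [integral_finsetSum _ fun i _ ↦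
      integrable_partialDeriv_of_locallyLipschitz (hF1 i).1 (hF1 i).2.1 i]
    exact Finset.sum_eq_zero fun i _ ↦ integral_partialDeriv_eq_zero (hF1 i).1 (hF1 i).2.1 i
  have hDt : ∫ y in (extChartAt (𝓡 n) c).target, ∑ i, partialDeriv i (F i) y = 0 := by
    rw [setIntegral_eq_integral_of_forall_compl_eq_zero, hD0]
    intro y hy
    refine Finset.sum_eq_zero fun i _ ↦ ?_
    have h1 : F i =ᶠ[nhds y] fun _ ↦ 0 :=
      notMem_tsupport_iff_eventuallyEq.1 fun h ↦ hy ((hF1 i).2.2 h)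
    rw [partialDeriv_congr i h1, partialDeriv_const]
  -- The product rule is available only where `ψ` is differentiable, that is almost everywhere by
  -- Rademacher.
  have hprod : ∀ᵐ y ∂(volume.restrict (extChartAt (𝓡 n) c).target),
      ∑ i, partialDeriv i (F i) y = w y * (inChart c ψ y * L y)
        + w y * gradDeriv n f ψ ((extChartAt (𝓡 n) c).symm y) := by
    rw [ae_restrict_iff' htm]
    filter_upwards [hψ.ae_differentiableAt] with y hd hy
    have hU := hto.mem_nhds hy
    have h1 : ∀ i, partialDeriv i (F i) y = inChart c ψ y * partialDeriv i (weightedFlux m f c i) y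
        + partialDeriv i (inChart c ψ) y * weightedFlux m f c i y := by
      intro i
      have h2 : F i =ᶠ[nhds y] fun z ↦ inChart c ψ z * weightedFlux m f c i z := by
        filter_upwards [hU] with z hz
        exact Set.indicator_of_mem hz _
      rw [partialDeriv_congr i h2, partialDeriv_mul i (hd hy)
        (((contDiffOn_weightedFlux hf m c i).contDiffAt hU).differentiableAt (by simp))]
    simp only [h1, Finset.sum_add_distrib, ← Finset.mul_sum]
    rw [sum_partialDeriv_weightedFlux hf m hy, gradDeriv_chart hy, hw, weightDensity]
    congr 1
    · ring
    · simp only [weightedFlux, Finset.mul_sum]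
      exact Finset.sum_congr rfl fun i _ ↦ Finset.sum_congr rfl fun j _ ↦ by ring
  -- Integrable as the divergence minus the Laplacian term.
  have hB : IntegrableOn (fun y ↦ w y * gradDeriv n f ψ ((extChartAt (𝓡 n) c).symm y))
      (extChartAt (𝓡 n) c).target := by
    refine (hDint.integrableOn.sub hA).congr ?_
    filter_upwards [hprod] with y hy
    rw [Pi.sub_apply, hy]
    ring
  have hgm := hψ.aestronglyMeasurable_gradDeriv hf (weightedVolume n m f)
  have hg0 : ∀ x ∉ (extChartAt (𝓡 n) c).source, gradDeriv n f ψ x = 0 := fun x hx ↦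
    gradDeriv_eq_zero_of_eventuallyEq_const (a := 0)
      (notMem_tsupport_iff_eventuallyEq.1 fun h ↦ hx (hψ.subset h))
  have hl0 : ∀ x ∉ (extChartAt (𝓡 n) c).source,
      ψ x * L (extChartAt (𝓡 n) c x) = 0 := fun x hx ↦ by rw [hψ.eq_zero hx, zero_mul]
  have hlm : AEStronglyMeasurable (fun x ↦ ψ x * L (extChartAt (𝓡 n) c x))
      (weightedVolume n m f) := by
    classical
    refine aestronglyMeasurable_of_chart (c := c) (H := (extChartAt (𝓡 n) c).target.piecewise
      (fun y ↦ inChart c ψ y * L y) 0) ?_ (fun y hy ↦ ?_) hl0 _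
    · refine ContinuousOn.measurable_piecewise ?_ continuousOn_const htm
      exact hψ.lipschitz.continuousOn.mul (continuousOn_chartWeightedLaplacian hf m c)
    · rw [Set.piecewise_eq_of_mem _ _ _ hy, (extChartAt (𝓡 n) c).right_inv hy]
      rfl
  have hA' : IntegrableOn (fun y ↦ w y * (ψ ((extChartAt (𝓡 n) c).symm y)
      * L (extChartAt (𝓡 n) c ((extChartAt (𝓡 n) c).symm y)))) (extChartAt (𝓡 n) c).target :=
    hA.congr_fun (fun y hy ↦ by simp only [(extChartAt (𝓡 n) c).right_inv hy]; rfl) htm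
  refine ⟨integrable_weightedVolume_chart hf m hgm hg0 hB,
    integrable_weightedVolume_chart hf m hlm hl0 hA', ?_⟩
  rw [integral_weightedVolume_chart hf m hgm hg0, integral_weightedVolume_chart hf m hlm hl0,
    eq_neg_iff_add_eq_zero, ← integral_add hA' hB, ← hDt]
  refine integral_congr_ae ?_
  filter_upwards [hprod, ae_restrict_mem htm] with y hy hyt
  rw [hy, (extChartAt (𝓡 n) c).right_inv hyt]
  rfl

end IntegrationByParts

/-! ### Chart independence and global integration by parts. -/

section Global

section Topological

variable {n : ℕ} {M : Type*} [TopologicalSpace M] [ChartedSpace (EuclideanSpace ℝ (Fin n)) M]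
  [IsManifold (𝓡 n) ∞ M]

lemma IsChartTest.of_contMDiff {c : M} {ψ : M → ℝ} (hψ : ContMDiff (𝓡 n) 𝓘(ℝ, ℝ) ∞ ψ)
    (hc : IsCompact (tsupport ψ)) (hs : tsupport ψ ⊆ (extChartAt (𝓡 n) c).source) :
    IsChartTest (n := n) c ψ := by
  refine ⟨hc, hs, fun y hy ↦ ?_⟩
  obtain ⟨K, t, ht, h⟩ := exists_lipschitzOnWith_of_contDiffOn (isOpen_extChartAt_target c)
    (contDiffOn_inChart hψ c) hy
  exact ⟨K, t, mem_nhdsWithin_of_mem_nhds ht, h⟩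

variable [RiemannianBundle (fun x : M ↦ TangentSpace (𝓡 n) x)]

lemma gradDeriv_sum {ι : Type*} {t : Finset ι} {f : M → ℝ} {ψ : ι → M → ℝ} {x : M}
    (h : ∀ i ∈ t, MDifferentiableAt (𝓡 n) 𝓘(ℝ, ℝ) (ψ i) x) :
    gradDeriv n f (fun z ↦ ∑ i ∈ t, ψ i z) x = ∑ i ∈ t, gradDeriv n f (ψ i) x := by
  obtain ⟨c, y, hy, rfl⟩ : ∃ c, ∃ y ∈ (extChartAt (𝓡 n) c).target,
      (extChartAt (𝓡 n) c).symm y = x :=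
    ⟨x, _, mem_extChartAt_target x, extChartAt_to_inv x⟩
  have h1 : ∀ i, partialDeriv i (inChart c fun z ↦ ∑ a ∈ t, ψ a z) y
      = ∑ a ∈ t, partialDeriv i (inChart c (ψ a)) y := fun i ↦
    partialDeriv_sum i fun a ha ↦ (mdifferentiableAt_iff_inChart hy _).1 (h a ha)
  simp only [gradDeriv_chart hy, h1, Finset.mul_sum]
  symm
  rw [Finset.sum_comm]
  exact Finset.sum_congr rfl fun i _ ↦ Finset.sum_comm

variable [IsContMDiffRiemannianBundle (𝓡 n) ∞ (EuclideanSpace ℝ (Fin n))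
      (fun x : M ↦ TangentSpace (𝓡 n) x)] [MeasurableSpace M] [BorelSpace M] {f : M → ℝ}

/-- In a chart the density is positive and Lebesgue measure charges nonempty open sets. -/
lemma weightedVolume_pos_of_isOpen (hf : ContMDiff (𝓡 n) 𝓘(ℝ, ℝ) ∞ f) (m : ℝ) {U : Set M}
    (hU : IsOpen U) (hne : U.Nonempty) : weightedVolume n m f U ≠ 0 := by
  intro h0
  obtain ⟨x, hx⟩ := hne
  have hto := isOpen_extChartAt_target (I := 𝓡 n) x
  set S := (extChartAt (𝓡 n) x).target ∩ (extChartAt (𝓡 n) x).symm ⁻¹' U with hS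
  have hSo : IsOpen S := (continuousOn_extChartAt_symm x).isOpen_inter_preimage hto hU
  have hSne : S.Nonempty := ⟨extChartAt (𝓡 n) x x, mem_extChartAt_target x, by
    rwa [Set.mem_preimage, extChartAt_to_inv]⟩
  have h1 : (weightedVolume n m f).restrict (extChartAt (𝓡 n) x).source U = 0 :=
    Measure.restrict_apply_eq_zero' (isOpen_extChartAt_source x).measurableSet |>.2
      (measure_mono_null Set.inter_subset_left h0)
  rw [weightedVolume_restrict_source hf, Measure.map_apply_of_aemeasurable
    (((continuousOn_extChartAt_symm x).aemeasurable hto.measurableSet).mono_ac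
      (withDensity_absolutelyContinuous _ _)) hU.measurableSet, withDensity_apply',
    Measure.restrict_restrict' hto.measurableSet, Set.inter_comm, ← hS,
    lintegral_eq_zero_iff'] at h1
  · have h2 : ∀ᵐ y ∂(volume.restrict S), False := by
      filter_upwards [h1, ae_restrict_mem hSo.measurableSet] with y hy hyS
      rw [Pi.zero_apply, ENNReal.ofReal_eq_zero] at hy
      exact absurd (weightDensity_pos m f hyS.1) (not_lt.2 hy)
    rw [Filter.eventually_false_iff_eq_bot, ae_eq_bot, Measure.restrict_eq_zero] at h2
    exact hSo.measure_ne_zero volume hSne h2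
  · exact (((contDiffOn_weightDensity hf m x).continuousOn.mono
      Set.inter_subset_left).aemeasurable hSo.measurableSet).ennreal_ofReal

/-- The weighted Laplacian does not depend on the chart in which it is computed. -/
lemma chartWeightedLaplacian_eq [T2Space M] (hf : ContMDiff (𝓡 n) 𝓘(ℝ, ℝ) ∞ f) (m : ℝ) {c x : M}
    (hx : x ∈ (extChartAt (𝓡 n) c).source) :
    chartWeightedLaplacian m f c (extChartAt (𝓡 n) c x) = weightedLaplacian n m f x := by
  rw [weightedLaplacian_eq_chart]
  set g : M → ℝ := fun z ↦ chartWeightedLaplacian m f c (extChartAt (𝓡 n) c z)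
    - chartWeightedLaplacian m f x (extChartAt (𝓡 n) x z) with hg
  by_contra hne
  have hgx : g x ≠ 0 := sub_ne_zero.2 hne
  have hcont : ∀ c : M, ContinuousOn
      (fun z ↦ chartWeightedLaplacian m f c (extChartAt (𝓡 n) c z)) (extChartAt (𝓡 n) c).source :=
    fun c ↦ (continuousOn_chartWeightedLaplacian hf m c).comp (continuousOn_extChartAt c)
      fun z hz ↦ (extChartAt (𝓡 n) c).map_source hz
  have hcs := (isOpen_extChartAt_source (I := 𝓡 n) c).mem_nhds hx
  have hxs := (isOpen_extChartAt_source (I := 𝓡 n) x).mem_nhds (mem_extChartAt_source x)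
  -- Multiplying by the constant `g x` makes the difference positive near `x` whatever its sign.
  -- Against a bump supported there its integral is zero, since integration by parts gives the same
  -- value in both charts.
  have hgc : ContinuousAt (fun z ↦ g z * g x) x :=
    (((hcont c).continuousAt hcs).sub ((hcont x).continuousAt hxs)).mul continuousAt_const
  have hV : ∀ᶠ z in nhds x, (0 < g z * g x ∧ z ∈ (extChartAt (𝓡 n) c).source)
      ∧ z ∈ (extChartAt (𝓡 n) x).source :=
    ((hgc.eventually (lt_mem_nhds (mul_self_pos.2 hgx))).and hcs).and hxs
  obtain ⟨ψ, -, hψ⟩ := (SmoothBumpFunction.nhds_basis_tsupport (I := 𝓡 n) x).mem_iff.1 hV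
  have hψsm : ContMDiff (𝓡 n) 𝓘(ℝ, ℝ) ∞ ψ := ψ.contMDiff
  obtain ⟨-, h1i, h1⟩ := (IsChartTest.of_contMDiff (c := c) hψsm ψ.hasCompactSupport
    fun z hz ↦ (hψ hz).1.2).integral_chart hf m
  obtain ⟨-, h2i, h2⟩ := (IsChartTest.of_contMDiff (c := x) hψsm ψ.hasCompactSupport
    fun z hz ↦ (hψ hz).2).integral_chart hf m
  have h3 : ∫ z, (ψ z * chartWeightedLaplacian m f c (extChartAt (𝓡 n) c z)
      - ψ z * chartWeightedLaplacian m f x (extChartAt (𝓡 n) x z)) * g x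
        ∂(weightedVolume n m f) = 0 := by
    rw [integral_mul_const, integral_sub h1i h2i, h1, h2, sub_self, zero_mul]
  have heq : ∀ z, (ψ z * chartWeightedLaplacian m f c (extChartAt (𝓡 n) c z)
      - ψ z * chartWeightedLaplacian m f x (extChartAt (𝓡 n) x z)) * g x
        = ψ z * (g z * g x) := fun z ↦ by simp only [hg]; ring
  have hnn : ∀ z, 0 ≤ ψ z * (g z * g x) := fun z ↦ by
    by_cases hz : z ∈ tsupport ψ
    · exact mul_nonneg ψ.nonneg (hψ hz).1.1.le
    · rw [image_eq_zero_of_notMem_tsupport hz, zero_mul]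
  have hint := ((h1i.sub h2i).mul_const (g x))
  simp only [Pi.sub_apply, heq] at h3 hint
  rw [integral_eq_zero_iff_of_nonneg hnn hint] at h3
  obtain ⟨W, hW, hWo, hxW⟩ := mem_nhds_iff.1 (hV.and ψ.eventuallyEq_one)
  refine weightedVolume_pos_of_isOpen hf m hWo ⟨x, hxW⟩ (measure_mono_null (fun z hz ↦ ?_) h3)
  intro h0
  have h5 := hW hz
  have h6 : ψ z = 1 := h5.2
  have h7 : ψ z * (g z * g x) = 0 := h0
  rw [h6, one_mul] at h7
  exact h5.1.1.1.ne' h7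

/-- The defining chart varies with the point, so continuity is not visible from the definition;
chart independence allows one fixed chart near `x`. -/
lemma continuous_weightedLaplacian [T2Space M] (hf : ContMDiff (𝓡 n) 𝓘(ℝ, ℝ) ∞ f) (m : ℝ) :
    Continuous (weightedLaplacian n m f) := by
  refine continuous_iff_continuousAt.2 fun x ↦ ?_
  have hxs := (isOpen_extChartAt_source (I := 𝓡 n) x).mem_nhds (mem_extChartAt_source x)
  have h1 : ContinuousAt (fun z ↦ chartWeightedLaplacian m f x (extChartAt (𝓡 n) x z)) x :=
    ((continuousOn_chartWeightedLaplacian hf m x).comp (continuousOn_extChartAt x)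
      fun z hz ↦ (extChartAt (𝓡 n) x).map_source hz).continuousAt hxs
  refine h1.congr ?_
  filter_upwards [hxs] with z hz using chartWeightedLaplacian_eq hf m hz

/-- Integration by parts against a function supported in a chart. -/
theorem IsChartTest.integral [T2Space M] (hf : ContMDiff (𝓡 n) 𝓘(ℝ, ℝ) ∞ f) (m : ℝ)
    {c : M} {ψ : M → ℝ} (hψ : IsChartTest (n := n) c ψ) :
    Integrable (gradDeriv n f ψ) (weightedVolume n m f) ∧
    Integrable (fun x ↦ ψ x * weightedLaplacian n m f x) (weightedVolume n m f) ∧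
    ∫ x, ψ x * weightedLaplacian n m f x ∂(weightedVolume n m f)
      = -∫ x, gradDeriv n f ψ x ∂(weightedVolume n m f) := by
  have h : (fun x ↦ ψ x * chartWeightedLaplacian m f c (extChartAt (𝓡 n) c x))
      = fun x ↦ ψ x * weightedLaplacian n m f x := by
    ext x
    by_cases hx : x ∈ (extChartAt (𝓡 n) c).source
    · rw [chartWeightedLaplacian_eq hf m hx]
    · rw [hψ.eq_zero hx, zero_mul, zero_mul]
  have := hψ.integral_chart hf m
  rwa [h] at this

end Topological

variable {n : ℕ} {M : Type*} [MetricSpace M] [ChartedSpace (EuclideanSpace ℝ (Fin n)) M]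
  [IsManifold (𝓡 n) ∞ M]
  [RiemannianBundle (fun x : M ↦ TangentSpace (𝓡 n) x)]
  [IsContMDiffRiemannianBundle (𝓡 n) ∞ (EuclideanSpace ℝ (Fin n))
      (fun x : M ↦ TangentSpace (𝓡 n) x)] [IsRiemannianManifold (𝓡 n) M]

lemma IsChartTest.mul_lipschitzWith {c : M} {η φ : M → ℝ} {K : NNReal}
    (hη : ContMDiff (𝓡 n) 𝓘(ℝ, ℝ) ∞ η) (hs : tsupport η ⊆ (extChartAt (𝓡 n) c).source)
    (hφ : LipschitzWith K φ) (hc : HasCompactSupport φ) :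
    IsChartTest (n := n) c (fun x ↦ η x * φ x) := by
  refine ⟨hc.mul_left, (closure_mono fun x hx ↦ ?_).trans hs, fun y hy ↦ ?_⟩
  · exact left_ne_zero_of_mul hx
  · have hU := (isOpen_extChartAt_target (I := 𝓡 n) c).mem_nhds hy
    obtain ⟨L, t, ht, hL⟩ := locallyLipschitzOn_inChart (n := n) hφ c hy
    rw [nhdsWithin_eq_nhds.2 hU] at ht
    obtain ⟨C, s, hs, hC⟩ := exists_lipschitzOnWith_mul
      (exists_lipschitzOnWith_of_contDiffOn (isOpen_extChartAt_target c)
        (contDiffOn_inChart hη c) hy) ⟨L, t, ht, hL⟩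
    exact ⟨C, s, mem_nhdsWithin_of_mem_nhds hs, hC⟩

/-- Integration by parts against a Lipschitz function with compact support. -/
theorem integral_mul_weightedLaplacian [MeasurableSpace M] [BorelSpace M] [SigmaCompactSpace M]
    {f : M → ℝ} (hf : ContMDiff (𝓡 n) 𝓘(ℝ, ℝ) ∞ f) (m : ℝ) {φ : M → ℝ} {K : NNReal}
    (hφ : LipschitzWith K φ) (hc : HasCompactSupport φ) :
    Integrable (fun x ↦ φ x * weightedLaplacian n m f x) (weightedVolume n m f) ∧
    ∫ x, φ x * weightedLaplacian n m f x ∂(weightedVolume n m f)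
      = -∫ x, gradDeriv n f φ x ∂(weightedVolume n m f) := by
  obtain ⟨t, ht⟩ := (show IsCompact (tsupport φ) from hc).elim_finite_subcover
    (fun c : M ↦ (extChartAt (𝓡 n) c).source) (fun c ↦ isOpen_extChartAt_source c)
    (fun x _ ↦ Set.mem_iUnion.2 ⟨x, mem_extChartAt_source x⟩)
  -- Indexing the partition by the finite subcover keeps all sums finite.
  obtain ⟨η, hη⟩ := SmoothPartitionOfUnity.exists_isSubordinate (𝓡 n) (isClosed_tsupport φ)
    (fun c : t ↦ (extChartAt (𝓡 n) (c : M)).source) (fun c ↦ isOpen_extChartAt_source _)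
    (fun x hx ↦ by simpa using ht hx)
  have hsum : ∀ x, φ x = ∑ c : t, η c x * φ x := by
    intro x
    by_cases hx : x ∈ tsupport φ
    · have := η.sum_eq_one hx
      rw [finsum_eq_sum_of_fintype] at this
      rw [← Finset.sum_mul, this, one_mul]
    · simp [image_eq_zero_of_notMem_tsupport hx]
  have htest : ∀ c : t, IsChartTest (n := n) (c : M) (fun x ↦ η c x * φ x) := fun c ↦
    IsChartTest.mul_lipschitzWith (η c).contMDiff (hη c) hφ hc
  have hI := fun c : t ↦ (htest c).integral hf m
  have h1 : (fun x ↦ φ x * weightedLaplacian n m f x)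
      = fun x ↦ ∑ c : t, (η c x * φ x) * weightedLaplacian n m f x := by
    ext x
    rw [← Finset.sum_mul, ← hsum]
  -- Additivity of the derivative needs every piece differentiable, which holds only almost
  -- everywhere.
  have h2 : gradDeriv n f φ =ᵐ[weightedVolume n m f]
      fun x ↦ ∑ c : t, gradDeriv n f (fun x ↦ η c x * φ x) x := by
    have hd : ∀ᵐ x ∂(weightedVolume n m f), ∀ c : t,
        MDifferentiableAt (𝓡 n) 𝓘(ℝ, ℝ) (fun x ↦ η c x * φ x) x :=
      ae_all_iff.2 fun c ↦ (htest c).ae_mdifferentiableAt hf m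
    filter_upwards [hd] with x hx
    rw [← gradDeriv_sum fun c _ ↦ hx c]
    congr 1
    ext z
    exact hsum z
  rw [h1]
  refine ⟨integrable_finsetSum _ fun c _ ↦ (hI c).2.1, ?_⟩
  rw [integral_congr_ae h2, integral_finsetSum _ fun c _ ↦ (hI c).2.1,
    integral_finsetSum _ fun c _ ↦ (hI c).1, ← Finset.sum_neg_distrib]
  exact Finset.sum_congr rfl fun c _ ↦ (hI c).2.2

end Global

/-! ### Lipschitz cutoff functions. -/

section Cutoff

/-- The cutoff function of radius `R` around `x₀`: it is `1` on the ball of radius `R` and `0` off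
the ball of radius `2 R`. -/
def cutoff {M : Type*} [MetricSpace M] (x₀ : M) (R : ℝ) (x : M) : ℝ :=
  max 0 (min 1 (2 - R⁻¹ * dist x x₀))

variable {M : Type*} [MetricSpace M] {x₀ : M} {R : ℝ}

lemma cutoff_nonneg (x : M) : 0 ≤ cutoff x₀ R x := le_max_left _ _

lemma lipschitzWith_cutoff (hR : 0 < R) : LipschitzWith (R⁻¹).toNNReal (cutoff x₀ R) := by
  have h : LipschitzWith (R⁻¹).toNNReal fun x ↦ 2 - R⁻¹ * dist x x₀ := by
    refine LipschitzWith.of_dist_le_mul fun x z ↦ ?_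
    rw [Real.coe_toNNReal _ (inv_nonneg.2 hR.le), Real.dist_eq]
    have h1 : 2 - R⁻¹ * dist x x₀ - (2 - R⁻¹ * dist z x₀) = R⁻¹ * (dist z x₀ - dist x x₀) := by ring
    rw [h1, abs_mul, abs_of_pos (inv_pos.2 hR), dist_comm x z]
    gcongr
    exact abs_dist_sub_le z x x₀
  exact (h.const_min 1).const_max 0

lemma cutoff_eq_one (hR : 0 < R) {x : M} (hx : dist x x₀ ≤ R) : cutoff x₀ R x = 1 := by
  have : R⁻¹ * dist x x₀ ≤ 1 := by rwa [inv_mul_le_iff₀ hR, mul_one]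
  rw [cutoff, min_eq_left (by linarith), max_eq_right zero_le_one]

lemma cutoff_eq_zero (hR : 0 < R) {x : M} (hx : 2 * R ≤ dist x x₀) : cutoff x₀ R x = 0 := by
  have : 2 ≤ R⁻¹ * dist x x₀ := by
    rw [le_inv_mul_iff₀ hR]; linarith
  rw [cutoff, max_eq_left]
  exact (min_le_right _ _).trans (by linarith)

lemma hasCompactSupport_cutoff [ProperSpace M] (hR : 0 < R) : HasCompactSupport (cutoff x₀ R) := by
  refine HasCompactSupport.intro (isCompact_closedBall x₀ (2 * R)) fun x hx ↦ cutoff_eq_zero hR ?_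
  simpa using (not_le.1 hx).le

end Cutoff

/-! ### The trace identity and the vanishing argument. -/

section Rigidity

variable {n : ℕ} {M : Type*}

/-- The trace of the soliton equation. -/
lemma weightedLaplacian_of_soliton [TopologicalSpace M]
    [ChartedSpace (EuclideanSpace ℝ (Fin n)) M] [IsManifold (𝓡 n) ∞ M]
    [RiemannianBundle (fun x : M ↦ TangentSpace (𝓡 n) x)] {k : ℕ} {m lam : ℝ} {f : M → ℝ}
    (h : IsQuasiYamabeGradientSoliton n M k m lam f) (x : M) :
    weightedLaplacian n m f x = n * (sigmaCurvature n k x - lam) := by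
  have hy := mem_extChartAt_target (I := 𝓡 n) x
  have h1 : ((metricAt n x)⁻¹ * dfAt n f x).trace
      = ∑ i, ∑ j, (metricAt n x)⁻¹ i j * partialDeriv j (inChart x f) (extChartAt (𝓡 n) x x)
          * partialDeriv i (inChart x f) (extChartAt (𝓡 n) x x) := by
    simp only [Matrix.trace, Matrix.diag, Matrix.mul_apply, dfAt, dfMatrix, Matrix.of_apply,
      mul_assoc]
  have h2 : (metricAt n x)⁻¹ * metricAt n x = 1 :=
    Matrix.nonsing_inv_mul _ (isUnit_iff_ne_zero.2 (det_metricMatrix_pos hy).ne')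
  have h3 := congrArg (fun A ↦ ((metricAt n x)⁻¹ * A).trace) (h.equation x)
  simp only [Matrix.mul_sub, Matrix.mul_smul, Matrix.trace_sub, Matrix.trace_smul, h2,
    Matrix.trace_one, Fintype.card_fin, smul_eq_mul, h1] at h3
  rw [weightedLaplacian_eq_chart, mul_comm (n : ℝ), ← h3]
  rfl

variable [MetricSpace M] [ChartedSpace (EuclideanSpace ℝ (Fin n)) M]
  [IsManifold (𝓡 n) ∞ M]
  [RiemannianBundle (fun x : M ↦ TangentSpace (𝓡 n) x)]
  [IsContMDiffRiemannianBundle (𝓡 n) ∞ (EuclideanSpace ℝ (Fin n))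
      (fun x : M ↦ TangentSpace (𝓡 n) x)] [IsRiemannianManifold (𝓡 n) M]

/-- The cutoff is locally constant where `d < R` or `d > 2 R`. In between it is `1/R`-Lipschitz and
`1/R ≤ 2/d`, which is the source of the factor `2`. -/
lemma enorm_gradDeriv_cutoff_le {f : M → ℝ} {x₀ : M} {R : ℝ} (hR : 0 < R) (x : M) :
    ‖gradDeriv n f (cutoff x₀ R) x‖ₑ ≤ (Metric.ball x₀ R)ᶜ.indicator
      (fun x ↦ 2 * ENNReal.ofReal ((dist x x₀)⁻¹ * ‖riemannianGradient n f x‖)) x := by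
  by_cases h1 : x ∈ Metric.ball x₀ R
  · have h2 : cutoff x₀ R =ᶠ[nhds x] fun _ ↦ 1 := by
      filter_upwards [Metric.isOpen_ball.mem_nhds h1] with z hz
      exact cutoff_eq_one hR (Metric.mem_ball.1 hz).le
    rw [gradDeriv_eq_zero_of_eventuallyEq_const h2, enorm_zero]
    exact bot_le
  rw [Set.indicator_of_mem (show x ∈ (Metric.ball x₀ R)ᶜ from h1)]
  have hRx : R ≤ dist x x₀ := not_lt.1 h1
  by_cases h3 : 2 * R < dist x x₀
  · have h2 : cutoff x₀ R =ᶠ[nhds x] fun _ ↦ 0 := by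
      have : IsOpen {z : M | 2 * R < dist z x₀} :=
        isOpen_lt continuous_const (continuous_id.dist continuous_const)
      filter_upwards [this.mem_nhds h3] with z hz
      exact cutoff_eq_zero hR (le_of_lt hz)
    rw [gradDeriv_eq_zero_of_eventuallyEq_const h2, enorm_zero]
    exact bot_le
  push Not at h3
  have hd : 0 < dist x x₀ := hR.trans_le hRx
  have h4 := abs_mvfderiv_le_of_lipschitzWith (n := n) (lipschitzWith_cutoff (x₀ := x₀) hR) x
    (riemannianGradient n f x)
  rw [Real.coe_toNNReal _ (inv_nonneg.2 hR.le)] at h4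
  have h5 : R⁻¹ ≤ 2 * (dist x x₀)⁻¹ := by
    rw [inv_le_iff_one_le_mul₀ hR, mul_assoc, mul_comm _ R, ← mul_assoc, ← div_eq_mul_inv,
      le_div_iff₀ hd, one_mul]
    exact h3
  rw [← ofReal_norm, Real.norm_eq_abs]
  have h6 : ∀ a : ℝ, (2 : ℝ≥0∞) * ENNReal.ofReal a = ENNReal.ofReal (2 * a) := fun a ↦ by
    rw [ENNReal.ofReal_mul zero_le_two, ENNReal.ofReal_ofNat]
  refine (ENNReal.ofReal_le_ofReal (h4.trans ?_)).trans_eq (h6 _).symm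
  rw [← mul_assoc]
  gcongr

variable [CompleteSpace M] [MeasurableSpace M] [BorelSpace M]

/-- On a complete Riemannian manifold, a function `f` with `Δf - (1/m) |∇f|² ≥ 0` for which
`d(x, x₀)⁻¹ |∇f|` is integrable at infinity satisfies `Δf - (1/m) |∇f|² = 0`. -/
theorem weightedLaplacian_eq_zero {f : M → ℝ} (hf : ContMDiff (𝓡 n) 𝓘(ℝ, ℝ) ∞ f) (m : ℝ)
    (x₀ : M) (r : ℝ)
    (hint : ∫⁻ x in (Metric.ball x₀ r)ᶜ,
        ENNReal.ofReal ((dist x x₀)⁻¹ * ‖riemannianGradient n f x‖) ∂(weightedVolume n m f) < ⊤)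
    (hsub : ∀ x : M, 0 ≤ weightedLaplacian n m f x) (x : M) :
    weightedLaplacian n m f x = 0 := by
  have hproper : ProperSpace M := properSpace_of_isRiemannianManifold n M
  set μ := weightedVolume n m f with hμ
  set h : M → ℝ≥0∞ := fun x ↦ ENNReal.ofReal ((dist x x₀)⁻¹ * ‖riemannianGradient n f x‖) with hh
  have hcont := continuous_weightedLaplacian hf m
  -- Test against the cutoff, which is `1` on this ball, and integrate by parts.
  have hbound : ∀ R > 0, ∫⁻ x in Metric.ball x₀ R, ENNReal.ofReal (weightedLaplacian n m f x) ∂μ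
      ≤ 2 * (μ.withDensity h) (Metric.ball x₀ R)ᶜ := by
    intro R hR
    obtain ⟨hi, he⟩ := integral_mul_weightedLaplacian hf m (lipschitzWith_cutoff (x₀ := x₀) hR)
      (hasCompactSupport_cutoff hR)
    calc ∫⁻ x in Metric.ball x₀ R, ENNReal.ofReal (weightedLaplacian n m f x) ∂μ
        ≤ ∫⁻ x in Metric.ball x₀ R,
            ENNReal.ofReal (cutoff x₀ R x * weightedLaplacian n m f x) ∂μ := by
          refine setLIntegral_mono' measurableSet_ball fun z hz ↦ ?_
          rw [cutoff_eq_one hR (Metric.mem_ball.1 hz).le, one_mul]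
      _ ≤ ∫⁻ x, ENNReal.ofReal (cutoff x₀ R x * weightedLaplacian n m f x) ∂μ :=
          setLIntegral_le_lintegral _ _
      _ = ENNReal.ofReal (∫ x, cutoff x₀ R x * weightedLaplacian n m f x ∂μ) :=
          (ofReal_integral_eq_lintegral_ofReal hi
            (.of_forall fun z ↦ mul_nonneg (cutoff_nonneg z) (hsub z))).symm
      _ ≤ ‖∫ x, gradDeriv n f (cutoff x₀ R) x ∂μ‖ₑ := by
          rw [he, ← ofReal_norm, Real.norm_eq_abs]
          exact ENNReal.ofReal_le_ofReal (neg_le_abs _)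
      _ ≤ ∫⁻ x, ‖gradDeriv n f (cutoff x₀ R) x‖ₑ ∂μ := enorm_integral_le_lintegral_enorm _
      _ ≤ ∫⁻ x, (Metric.ball x₀ R)ᶜ.indicator (fun x ↦ 2 * h x) x ∂μ :=
          lintegral_mono fun z ↦ enorm_gradDeriv_cutoff_le hR z
      _ = 2 * (μ.withDensity h) (Metric.ball x₀ R)ᶜ := by
          rw [lintegral_indicator measurableSet_ball.compl,
            lintegral_const_mul' _ _ (by simp), withDensity_apply _ measurableSet_ball.compl]
  -- Continuity from above of the measure with density `h`: complements of balls decrease to the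
  -- empty set, and have finite mass once the radius passes `r`.
  have htail : Filter.Tendsto (fun k : ℕ ↦ 2 * (μ.withDensity h) (Metric.ball x₀ k)ᶜ)
      Filter.atTop (nhds 0) := by
    have h1 : Filter.Tendsto (fun k : ℕ ↦ (μ.withDensity h) (Metric.ball x₀ k)ᶜ)
        Filter.atTop (nhds ((μ.withDensity h) (⋂ k : ℕ, (Metric.ball x₀ k)ᶜ))) := by
      refine tendsto_measure_iInter_atTop
        (fun k ↦ measurableSet_ball.compl.nullMeasurableSet) (fun k l hkl ↦ ?_) ?_
      · exact Set.compl_subset_compl.2 (Metric.ball_subset_ball (Nat.cast_le.2 hkl))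
      · obtain ⟨k, hk⟩ := exists_nat_ge r
        refine ⟨k, ne_top_of_le_ne_top hint.ne ?_⟩
        rw [withDensity_apply _ measurableSet_ball.compl]
        exact lintegral_mono_set (Set.compl_subset_compl.2 (Metric.ball_subset_ball hk))
    have h2 : (⋂ k : ℕ, (Metric.ball x₀ (k : ℝ))ᶜ) = ∅ := by
      rw [← Set.compl_iUnion, Metric.iUnion_ball_nat, Set.compl_univ]
    rw [h2, measure_empty] at h1
    simpa using ENNReal.Tendsto.const_mul h1 (Or.inr (by simp : (2 : ℝ≥0∞) ≠ ⊤))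
  have hzero : ∀ R, ∫⁻ x in Metric.ball x₀ R,
      ENNReal.ofReal (weightedLaplacian n m f x) ∂μ = 0 := by
    intro R
    refine le_antisymm (ge_of_tendsto htail ?_) bot_le
    -- The `1` keeps the cutoff radius positive when `R ≤ 0`.
    obtain ⟨k, hk⟩ := exists_nat_ge (max R 1)
    filter_upwards [Filter.eventually_ge_atTop k] with l hl
    have hl' : max R 1 ≤ (l : ℝ) := hk.trans (Nat.cast_le.2 hl)
    exact (lintegral_mono_set (Metric.ball_subset_ball ((le_max_left _ _).trans hl'))).trans
      (hbound l (lt_of_lt_of_le one_pos ((le_max_right _ _).trans hl')))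
  by_contra hne
  have hxR : x ∈ Metric.ball x₀ (dist x x₀ + 1) := Metric.mem_ball.2 (lt_add_one _)
  have h1 := hzero (dist x x₀ + 1)
  rw [lintegral_eq_zero_iff hcont.measurable.ennreal_ofReal, Filter.EventuallyEq,
    ae_restrict_iff' measurableSet_ball] at h1
  have hopen : IsOpen (Metric.ball x₀ (dist x x₀ + 1) ∩ {z | weightedLaplacian n m f z ≠ 0}) :=
    Metric.isOpen_ball.inter (isOpen_ne_fun hcont continuous_const)
  -- Vanishing almost everywhere is vanishing everywhere: the set where a continuous function is
  -- nonzero is open, so it would have positive measure.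
  refine weightedVolume_pos_of_isOpen hf m hopen ⟨x, hxR, hne⟩
    (measure_mono_null (fun z hz ↦ ?_) h1)
  intro h2
  have h3 := h2 hz.1
  rw [Pi.zero_apply, ENNReal.ofReal_eq_zero] at h3
  exact hz.2 (le_antisymm h3 (hsub z))

end Rigidity

end QuasiYamabe

end

theorem theorem1p4 {n k : ℕ} (hn : 3 ≤ n) (hk : 1 ≤ k) (hkn : k ≤ n)
    {M : Type*} [MetricSpace M] [ConnectedSpace M] [SecondCountableTopology M]
    [ChartedSpace (EuclideanSpace ℝ (Fin n)) M] [IsManifold (𝓡 n) ∞ M]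
    [Bundle.RiemannianBundle (fun x : M ↦ TangentSpace (𝓡 n) x)]
    [IsContMDiffRiemannianBundle (𝓡 n) ∞ (EuclideanSpace ℝ (Fin n))
      (fun x : M ↦ TangentSpace (𝓡 n) x)]
    [IsRiemannianManifold (𝓡 n) M]
    [CompleteSpace M] [NoncompactSpace M] [MeasurableSpace M] [BorelSpace M]
    (m lam : ℝ) (f : M → ℝ)
    (hsoliton : QuasiYamabe.IsQuasiYamabeGradientSoliton n M k m lam f)
    (x₀ : M) (r : ℝ) (hr : 0 < r)
    (hint : ∫⁻ x in (Metric.ball x₀ r)ᶜ,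
        ENNReal.ofReal ((dist x x₀)⁻¹ * ‖QuasiYamabe.riemannianGradient n f x‖)
          ∂(QuasiYamabe.weightedVolume n m f) < ⊤)
    (hsub : ∀ x : M,
      0 ≤ QuasiYamabe.laplacian n f x
        - (1 / m) * ‖QuasiYamabe.riemannianGradient n f x‖ ^ 2) :
    ∀ x : M, QuasiYamabe.sigmaCurvature n k x = lam := by
  intro x
  have h := QuasiYamabe.weightedLaplacian_eq_zero hsoliton.smooth m x₀ r hint hsub x
  rw [QuasiYamabe.weightedLaplacian_of_soliton hsoliton, mul_eq_zero, Nat.cast_eq_zero] at h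
  rcases h with h | h
  -- The dimension factor `n` from the trace is nonzero.
  · omega
  · exact sub_eq_zero.1 h
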